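/- A permutation $\pi=\pi_1\cdots\pi_n\in\mathfrak S_n$ contains $1\text{-}3\text{-}2$ exactly once if there is exactly one triple $i<j<k$ with $\pi_i<\pi_k<\pi_j$. For $n\ge 2$, call $\pi$ up-down (respectively up-up, down-up, down-down) if its rises and descents come in turn, it starts with a rise (respectively rise, descent, descent), and it ends with a descent (respectively rise, rise, descent); for $n=0,1$ there are no permutations of these four types. Call $\pi$ alternating if $\pi_1<\pi_2>\pi_3<\cdots$ (the permutations of length $0$ and $1$ are alternating). Let $\binom ab$ be $0$ whenever $a<b$, $b<0$, or $b$ is not an integer, and let $\sqrt{1-4x^2}$ be the formal power series with constant term $1$ and square $1-4x^2$. Generating functions are $\sum_{n\ge0}a_nx^n$, and the identities below hold between formal Laurent series over $\mathbb Q$. 1. The generating function for the number of up-down permutations in $\mathfrak S_n$ containing $1\text{-}3\text{-}2$ exactly once is $$\frac{x(1-\sqrt{1-4x^2})}{1-4x^2+\sqrt{1-4x^2}},$$ and for every $n\ge0$ their number is $\binom{n-1}{(n-3)/2}$. 2. The generating function for the number of up-up permutations in $\mathfrak S_n$ containing $1\text{-}3\text{-}2$ exactly once is $$\frac{x^2-1}{x^2}+\frac{1-3x^2}{x^2\sqrt{1-4x^2}},$$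 and for every $n\ge0$ their number is $2\binom{n-1}{(n-4)/2}$. 3. The generating function for the number of down-down permutations in $\mathfrak S_n$ containing $1\text{-}3\text{-}2$ exactly once is $$\frac{x^2-1}{x^2}+\frac{1-3x^2}{x^2\sqrt{1-4x^2}},$$ and for every $n\ge0$ their number is $2\binom{n-1}{(n-4)/2}$. 4. The generating function for the number of down-up permutations in $\mathfrak S_n$ containing $1\text{-}3\text{-}2$ exactly once is $$\frac{2x^4+4x^2-3}{2x^3}+\frac{3-10x^2}{2x^3\sqrt{1-4x^2}},$$ and for every $n\ge0$ with $n\ne1$ their number is $\frac32\binom{n+3}{(n+3)/2}-5\binom{n+1}{(n+1)/2}$. 5. For every $n\ge0$ the number of alternating permutations in $\mathfrak S_n$ containing $1\text{-}3\text{-}2$ exactly once is $\binom{n-1}{(n-3)/2}+2\binom{n-1}{(n-4)/2}$. -/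

import Mathlib

namespace Alt132

/-- The number of occurrences of the classical pattern `1-3-2` in the permutation `π` (with entries
`π 0, π 1, …` in one-line notation): the number of position triples `i < j < k` such that
`(π i, π j, π k)` is order-isomorphic to `(1, 3, 2)`. -/
def occ132 {n : ℕ} (π : Equiv.Perm (Fin n)) : ℕ :=
  (Finset.univ.filter fun t : Fin n × Fin n × Fin n =>
    t.1 < t.2.1 ∧ t.2.1 < t.2.2 ∧ π t.1 < π t.2.2 ∧ π t.2.2 < π t.2.1).card

/-- `π` has a rise at the (0-based) index `i`: the positions `i` and `i + 1` both exist
and the entry increases from the first to the second. -/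
def RiseAt {n : ℕ} (π : Equiv.Perm (Fin n)) (i : ℕ) : Prop :=
  ∃ h : i + 1 < n, π ⟨i, Nat.lt_of_succ_lt h⟩ < π ⟨i + 1, h⟩

/-- `π` has a descent at the (0-based) index `i`. -/
def DescentAt {n : ℕ} (π : Equiv.Perm (Fin n)) (i : ℕ) : Prop :=
  ∃ h : i + 1 < n, π ⟨i + 1, h⟩ < π ⟨i, Nat.lt_of_succ_lt h⟩

/-- Rises and descents of `π` come in turn. -/
def InTurn {n : ℕ} (π : Equiv.Perm (Fin n)) : Prop :=
  ∀ i : ℕ, i + 2 < n → (RiseAt π i ↔ DescentAt π (i + 1))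

/-- Starts with a rise, ends with a descent, rises and descents in turn. The last index at
which there is a rise or a descent is `n - 2`; there is none of this kind when `n < 2`. -/
def IsUpDown {n : ℕ} (π : Equiv.Perm (Fin n)) : Prop :=
  2 ≤ n ∧ RiseAt π 0 ∧ InTurn π ∧ DescentAt π (n - 2)

/-- Starts with a rise, ends with a rise, rises and descents in turn. -/
def IsUpUp {n : ℕ} (π : Equiv.Perm (Fin n)) : Prop :=
  2 ≤ n ∧ RiseAt π 0 ∧ InTurn π ∧ RiseAt π (n - 2)

/-- Starts with a descent, ends with a descent, rises and descents in turn. -/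
def IsDownDown {n : ℕ} (π : Equiv.Perm (Fin n)) : Prop :=
  2 ≤ n ∧ DescentAt π 0 ∧ InTurn π ∧ DescentAt π (n - 2)

/-- Starts with a descent, ends with a rise, rises and descents in turn. -/
def IsDownUp {n : ℕ} (π : Equiv.Perm (Fin n)) : Prop :=
  2 ≤ n ∧ DescentAt π 0 ∧ InTurn π ∧ RiseAt π (n - 2)

/-- Alternating permutations: `π₁ < π₂ > π₃ < π₄ > ⋯` (the 0-based index of a rise is even,
that of a descent is odd). The permutations of length `0` and `1` are alternating. -/
def IsAlternating {n : ℕ} (π : Equiv.Perm (Fin n)) : Prop :=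
  ∀ i : ℕ, i + 1 < n → if Even i then RiseAt π i else DescentAt π i

/-- The number of permutations of length `n` with the property `P` that contain `1-3-2`
exactly once. -/
noncomputable def countOnce (n : ℕ) (P : Equiv.Perm (Fin n) → Prop) : ℕ :=
  Nat.card {π : Equiv.Perm (Fin n) // P π ∧ occ132 π = 1}

/-- The generating function `∑ₙ aₙ xⁿ` of a sequence, in the field of formal Laurent series. -/
noncomputable def genFun (a : ℕ → ℕ) : LaurentSeries ℚ :=
  HahnSeries.ofPowerSeries ℤ ℚ (PowerSeries.mk fun n => (a n : ℚ))

/-- The variable `x` of the field of formal Laurent series. -/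
noncomputable def x : LaurentSeries ℚ :=
  HahnSeries.ofPowerSeries ℤ ℚ PowerSeries.X

/-- The formal power series `√(1 - 4x²) = 1 - 2x² ∑ₘ Cₘ x²ᵐ`, `Cₘ` the Catalan numbers. It is
the only power series with constant term `1` and square `1 - 4x²`, as shown below. -/
noncomputable def rootPS : PowerSeries ℚ :=
  1 - 2 * PowerSeries.X ^ 2 *
    PowerSeries.expand 2 two_ne_zero (PowerSeries.map (Nat.castRingHom ℚ) PowerSeries.catalanSeries)

theorem rootPS_constantCoeff : PowerSeries.constantCoeff rootPS = 1 := by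
  simp [rootPS]

theorem rootPS_sq : rootPS ^ 2 = 1 - 4 * PowerSeries.X ^ 2 := by
  have h := congrArg (fun f => PowerSeries.expand (R := ℚ) 2 two_ne_zero
    (PowerSeries.map (Nat.castRingHom ℚ) f)) PowerSeries.catalanSeries_sq_mul_X_add_one
  simp only [map_add, map_mul, map_pow, PowerSeries.map_X, PowerSeries.expand_X, map_one] at h
  unfold rootPS
  linear_combination (-4 * (PowerSeries.X : PowerSeries ℚ) ^ 2) * -h

theorem rootPS_unique (s : PowerSeries ℚ) (h0 : PowerSeries.constantCoeff s = 1)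
    (h2 : s ^ 2 = 1 - 4 * PowerSeries.X ^ 2) : s = rootPS := by
  rcases sq_eq_sq_iff_eq_or_eq_neg.mp (h2.trans rootPS_sq.symm) with h | h
  · exact h
  · have := congrArg PowerSeries.constantCoeff h
    rw [h0, map_neg, rootPS_constantCoeff] at this
    norm_num at this

/-- `√(1 - 4x²)` in the field of formal Laurent series. -/
noncomputable def root : LaurentSeries ℚ :=
  HahnSeries.ofPowerSeries ℤ ℚ rootPS

/-- The binomial coefficient `binom(a, b)`, taken to be `0` when `a < b`, `b < 0`, or `b` is not
an integer. -/
def binom (a : ℤ) (b : ℚ) : ℚ :=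
  if b.den = 1 ∧ 0 ≤ b ∧ b ≤ (a : ℚ) then (Nat.choose a.toNat b.num.toNat : ℚ) else 0

end Alt132

/-!
A permutation is written as the word of its letters and split at its largest letter, as
`L ++ M :: R`. In an alternating word of length at least `2` the maximum is a peak, so the parity
of the length of `L` is fixed by the first step, `L` is alternating with the same first step, and
`R` is alternating and begins with a rise (`alternates_append_max`). With the first step and the
length, the last step is known too, so the four types of the theorem are a Boolean `s` (the first
step) and a parity of the length.

If the word avoids `1-3-2`, all letters of `L` are larger than all letters of `R`, and both parts
avoid the pattern. This is the Catalan recurrence: there are `catalan (n / 2)` avoiding words that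
begin with a rise and `catalan ((n + 1) / 2)` that begin with a descent (`card_avoidSet`).

If the word contains `1-3-2` exactly once, there are two cases. Either all letters of `L` are larger
than all letters of `R`, and the occurrence lies in one of the two parts while the other part avoids
the pattern (`containsOnce_append_max_of_gt`); or the occurrence is `a, M, c` with `a` in `L` and
`c` in `R`. In the second case `a` is the last letter of `L`, as any letter between `a` and `M` would be
larger than `c` and so give another occurrence; moreover `a < c` are the only letters in the wrong
order across `M`, and apart from `a` both parts are arbitrary avoiding words
(`containsOnce_append_max_of_lt`, `containsOnce_append_append_max`). All these sets of words depend
on the alphabet only through its cardinality, which gives the recurrence `onceNum_succ`.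

Let `C` be the Catalan series in `y = x²`, let `G = y C`, and let `D`, `E`, `F` be the series of the
words with one occurrence that begin with a rise and have odd length (`D`), that have even length
(`E`, the same for both first steps), and that begin with a descent and have odd length (`F`). The
recurrence says `D = 2GD + GC`, `E = G(D + E + C - 1)`, `F = 2EC + (C - 1)²`. As `y = G - G²` and
`1 - 2G = √(1 - 4y)`, whose inverse is the series of the central binomial coefficients
(`centralSeries_mul`), these equations are solved rationally in terms of `G`, and both the
generating functions and the numbers can be read off.
-/

namespace Alt132

/-! ### Words, alternation and occurrences of `1-3-2` -/

/-- The list `l` alternates, beginning with a rise if `s` is `true` and with a descent if `s` is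
`false`. Every list of length at most `1` alternates, for both values of `s`. -/
def Alternates : Bool → List ℕ → Prop
  | _, [] => True
  | _, [_] => True
  | s, a :: b :: l => (if s then a < b else b < a) ∧ Alternates (!s) (b :: l)

/-- The letters `a`, `b`, `c` form an occurrence of `1-3-2` in the word `l`. In a word without
repetitions this is the same as an occurrence at given positions. -/
def Occurs (l : List ℕ) (a b c : ℕ) : Prop :=
  [a, b, c].Sublist l ∧ a < c ∧ c < b

/-- The word `l` avoids `1-3-2`. -/
def Avoids (l : List ℕ) : Prop :=
  ∀ a b c, ¬ Occurs l a b c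

/-- The word `l` contains `1-3-2` exactly once. -/
def ContainsOnce (l : List ℕ) : Prop :=
  ∃ a b c, Occurs l a b c ∧ ∀ a' b' c', Occurs l a' b' c' → a' = a ∧ b' = b ∧ c' = c

theorem alternates_append_max {M : ℕ} {R : List ℕ} (hR : ∀ x ∈ R, x < M) :
    ∀ {L : List ℕ} (s : Bool), (∀ x ∈ L, x < M) →
      (Alternates s (L ++ M :: R) ↔
        Alternates s L ∧ Alternates true R ∧ (L.length + R.length ≠ 0 → L.length.bodd = s)) := by
  intro L
  induction L with
  | nil =>
    intro s _
    cases R with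
    | nil => simp [Alternates]
    | cons b R =>
      have hb : b < M := hR b (by simp)
      cases s <;> simp [Alternates, hb, hb.le]
  | cons a L ih =>
    intro s hL
    have ha : a < M := hL a (by simp)
    cases L with
    | nil =>
      have := ih (!s) (by simp)
      cases s
      · simp [Alternates, ha.le]
      · simp only [List.nil_append, Alternates, Bool.not_true, true_and] at this
        simpa [Alternates, ha] using this
    | cons b L =>
      have := ih (!s) (fun x hx => hL x (by simp [hx]))
      simp only [List.cons_append] at this ⊢
      rw [Alternates, this, Alternates]
      simp only [List.length_cons, Nat.bodd_succ]
      generalize L.length.bodd = t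
      cases s <;> cases t <;> simp [and_assoc]

theorem alternates_append_min {a : ℕ} :
    ∀ {L : List ℕ} (s : Bool), (∀ x ∈ L, a < x) →
      (Alternates s (L ++ [a]) ↔ Alternates s L ∧ (L ≠ [] → L.length.bodd = !s)) := by
  intro L
  induction L with
  | nil => simp [Alternates]
  | cons b L ih =>
    intro s hL
    have hb : a < b := hL b (by simp)
    cases L with
    | nil => cases s <;> simp [Alternates, hb, hb.le]
    | cons c L =>
      have := ih (!s) (fun x hx => hL x (by simp [hx]))
      simp only [List.cons_append] at this ⊢
      rw [Alternates, this, Alternates]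
      simp only [List.length_cons, Nat.bodd_succ]
      generalize L.length.bodd = t
      cases s <;> cases t <;> simp

theorem Occurs.mono {l l' : List ℕ} (h : l.Sublist l') {a b c : ℕ} (ho : Occurs l a b c) :
    Occurs l' a b c :=
  ⟨ho.1.trans h, ho.2⟩

theorem Avoids.mono {l l' : List ℕ} (h : l.Sublist l') (ha : Avoids l') : Avoids l :=
  fun a b c ho => ha a b c (ho.mono h)

theorem triple_sublist_append {L R : List ℕ} {a b c : ℕ} :
    [a, b, c].Sublist (L ++ R) ↔ [a, b, c].Sublist L ∨ ([a, b].Sublist L ∧ c ∈ R) ∨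
      (a ∈ L ∧ [b, c].Sublist R) ∨ [a, b, c].Sublist R := by
  rw [List.sublist_append_iff]
  constructor
  · rintro ⟨l₁, l₂, h, h₁, h₂⟩
    rcases l₁ with _ | ⟨x, _ | ⟨y, _ | ⟨z, _ | ⟨w, l⟩⟩⟩⟩ <;> simp at h
    · subst h; simp [h₂]
    · obtain ⟨rfl, rfl⟩ := h; simp_all
    · obtain ⟨rfl, rfl, rfl⟩ := h; simp_all
    · obtain ⟨rfl, rfl, rfl, rfl⟩ := h; simp_all
  · rintro (h | ⟨h, h'⟩ | ⟨h, h'⟩ | h)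
    · exact ⟨_, [], by simp, h, by simp⟩
    · exact ⟨[a, b], [c], by simp, h, by simpa⟩
    · exact ⟨[a], [b, c], by simp, by simpa, h'⟩
    · exact ⟨[], _, by simp, by simp, h⟩

theorem occurs_append_max {L R : List ℕ} {M : ℕ} (hL : ∀ x ∈ L, x < M) (hR : ∀ x ∈ R, x < M)
    {a b c : ℕ} :
    Occurs (L ++ M :: R) a b c ↔ Occurs L a b c ∨ Occurs R a b c ∨
      (a ∈ L ∧ b = M ∧ c ∈ R ∧ a < c) ∨
      ([a, b].Sublist L ∧ c ∈ R ∧ a < c ∧ c < b) ∨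
      (a ∈ L ∧ [b, c].Sublist R ∧ a < c ∧ c < b) := by
  have mem2 : ∀ {l : List ℕ} {x y : ℕ}, [x, y].Sublist l → x ∈ l ∧ y ∈ l :=
    fun h => ⟨h.subset (by simp), h.subset (by simp)⟩
  have mem3 : ∀ {l : List ℕ} {x y z : ℕ}, [x, y, z].Sublist l → x ∈ l ∧ y ∈ l ∧ z ∈ l :=
    fun h => ⟨h.subset (by simp), h.subset (by simp), h.subset (by simp)⟩
  unfold Occurs
  rw [triple_sublist_append]
  constructor
  · rintro ⟨h, hac, hcb⟩
    rcases h with h | ⟨h, h'⟩ | ⟨h, h'⟩ | h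
    · exact Or.inl ⟨h, hac, hcb⟩
    · rcases List.mem_cons.mp h' with rfl | h'
      · have := hL _ (mem2 h).2
        omega
      · simp_all
    · rw [List.sublist_cons_iff] at h'
      rcases h' with h' | ⟨r, hr, h'⟩
      · simp_all
      · simp at hr
        obtain ⟨rfl, rfl⟩ := hr
        simp_all
    · rw [List.sublist_cons_iff] at h
      rcases h with h | ⟨r, hr, h⟩
      · simp_all
      · simp at hr
        obtain ⟨rfl, rfl⟩ := hr
        have := hR _ (mem2 h).2
        omega
  · rintro (⟨h, hac, hcb⟩ | ⟨h, hac, hcb⟩ | ⟨h, rfl, h', hac⟩ | ⟨h, h', hac, hcb⟩ |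
      ⟨h, h', hac, hcb⟩)
    · exact ⟨Or.inl h, hac, hcb⟩
    · exact ⟨Or.inr <| Or.inr <| Or.inr <| h.trans (List.sublist_cons_self _ _), hac, hcb⟩
    · exact ⟨Or.inr <| Or.inr <| Or.inl ⟨h, by simpa using h'⟩, hac, hR _ h'⟩
    · exact ⟨Or.inr <| Or.inl ⟨h, by simp [h']⟩, hac, hcb⟩
    · exact ⟨Or.inr <| Or.inr <| Or.inl ⟨h, h'.trans (List.sublist_cons_self _ _)⟩, hac, hcb⟩

/-- Appending the smallest letter creates no occurrence, as the letter could only play the role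
of the `2`. -/
theorem occurs_append_min {L : List ℕ} {m : ℕ} (hL : ∀ x ∈ L, m < x) {a b c : ℕ} :
    Occurs (L ++ [m]) a b c ↔ Occurs L a b c := by
  refine ⟨fun ⟨h, hac, hcb⟩ => ?_, fun h => h.mono (List.sublist_append_left _ _)⟩
  rw [triple_sublist_append] at h
  rcases h with h | ⟨h, h'⟩ | ⟨_, h'⟩ | h'
  · exact ⟨h, hac, hcb⟩
  · have := hL a (h.subset (by simp))
    simp at h'
    omega
  · simpa using h'.length_le
  · simpa using h'.length_le

theorem avoids_append_max {L R : List ℕ} {M : ℕ} (hL : ∀ x ∈ L, x < M) (hR : ∀ x ∈ R, x < M)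
    (hLR : ∀ x ∈ L, ∀ y ∈ R, x ≠ y) :
    Avoids (L ++ M :: R) ↔ Avoids L ∧ Avoids R ∧ ∀ x ∈ L, ∀ y ∈ R, y < x := by
  constructor
  · intro h
    refine ⟨h.mono (by simp), h.mono (by simp), fun x hx y hy => ?_⟩
    by_contra hxy
    have := hLR x hx y hy
    exact h x M y ((occurs_append_max hL hR).mpr (Or.inr <| Or.inr <| Or.inl
      ⟨hx, rfl, hy, by omega⟩))
  · rintro ⟨h₁, h₂, h₃⟩ a b c h
    rcases (occurs_append_max hL hR).mp h with h | h | ⟨h, -, h', hac⟩ | ⟨h, h', hac, hcb⟩ |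
      ⟨h, h', hac, hcb⟩
    · exact h₁ _ _ _ h
    · exact h₂ _ _ _ h
    · have := h₃ _ h _ h'
      omega
    · have := h₃ a (h.subset (by simp)) _ h'
      omega
    · have := h₃ _ h c (h'.subset (by simp))
      omega

/-- If no letter before the maximum is smaller than a letter after it, then the only occurrence
lies on one side of the maximum. -/
theorem containsOnce_append_max_of_gt {L R : List ℕ} {M : ℕ} (hL : ∀ x ∈ L, x < M)
    (hR : ∀ x ∈ R, x < M) (hLR : ∀ x ∈ L, ∀ y ∈ R, y < x) :
    ContainsOnce (L ++ M :: R) ↔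
      (ContainsOnce L ∧ Avoids R) ∨ (Avoids L ∧ ContainsOnce R) := by
  have key : ∀ a b c, Occurs (L ++ M :: R) a b c ↔ Occurs L a b c ∨ Occurs R a b c := by
    intro a b c
    rw [occurs_append_max hL hR]
    constructor
    · rintro (h | h | ⟨h, -, h', hac⟩ | ⟨h, h', hac, hcb⟩ | ⟨h, h', hac, hcb⟩)
      · exact Or.inl h
      · exact Or.inr h
      · have := hLR _ h _ h'
        omega
      · have := hLR a (h.subset (by simp)) _ h'
        omega
      · have := hLR _ h c (h'.subset (by simp))
        omega
    · tauto
  -- the same triple of letters cannot occur on both sides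
  have disj : ∀ a b c, Occurs L a b c → ¬ Occurs R a b c := fun a b c h h' =>
    (hLR a (h.1.subset (by simp)) a (h'.1.subset (by simp))).false
  unfold ContainsOnce Avoids
  simp only [key]
  constructor
  · rintro ⟨a, b, c, h | h, hu⟩
    · refine Or.inl ⟨⟨a, b, c, h, fun _ _ _ h' => hu _ _ _ (Or.inl h')⟩, fun a' b' c' h' => ?_⟩
      obtain ⟨rfl, rfl, rfl⟩ := hu _ _ _ (Or.inr h')
      exact disj _ _ _ h h'
    · refine Or.inr ⟨fun a' b' c' h' => ?_, ⟨a, b, c, h, fun _ _ _ h' => hu _ _ _ (Or.inr h')⟩⟩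
      obtain ⟨rfl, rfl, rfl⟩ := hu _ _ _ (Or.inl h')
      exact disj _ _ _ h' h
  · rintro (⟨⟨a, b, c, h, hu⟩, h₂⟩ | ⟨h₂, ⟨a, b, c, h, hu⟩⟩)
    · exact ⟨a, b, c, Or.inl h, fun a' b' c' h' => hu _ _ _ (h'.resolve_right (h₂ _ _ _))⟩
    · exact ⟨a, b, c, Or.inr h, fun a' b' c' h' => hu _ _ _ (h'.resolve_left (h₂ _ _ _))⟩

/-- If the only occurrence is `a, M, c` with `M` the maximum, then `a` stands right before `M`,
and `a`, `c` are the only letters in the wrong order across `M`. -/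
theorem containsOnce_append_max_of_lt {L R : List ℕ} {M : ℕ} (hL : ∀ x ∈ L, x < M)
    (hR : ∀ x ∈ R, x < M) (hLR : ∀ x ∈ L, ∀ y ∈ R, x ≠ y) (hnd : L.Nodup)
    {a c : ℕ} (ha : a ∈ L) (hc : c ∈ R) (hac : a < c) (h : ContainsOnce (L ++ M :: R)) :
    ∃ L', L = L' ++ [a] ∧ Avoids L' ∧ Avoids R ∧ (∀ x ∈ L', a < x) ∧ (∀ x ∈ L', ∀ y ∈ R, y < x) ∧
      ∀ y ∈ R, y ≠ c → y < a := by
  obtain ⟨a₀, b₀, c₀, -, hu⟩ := h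
  have hu' : ∀ x y z, Occurs (L ++ M :: R) x y z → x = a ∧ y = M ∧ z = c := by
    intro x y z h
    have h₁ := hu x y z h
    have h₂ := hu a M c ((occurs_append_max hL hR).mpr (Or.inr <| Or.inr <| Or.inl
      ⟨ha, rfl, hc, hac⟩))
    exact ⟨h₁.1.trans h₂.1.symm, h₁.2.1.trans h₂.2.1.symm, h₁.2.2.trans h₂.2.2.symm⟩
  have hu₁ : ∀ x ∈ L, ∀ z ∈ R, x < z → x = a ∧ z = c := by
    intro x hx z hz hxz
    have := hu' x M z ((occurs_append_max hL hR).mpr (Or.inr <| Or.inr <| Or.inl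
      ⟨hx, rfl, hz, hxz⟩))
    exact ⟨this.1, this.2.2⟩
  have hgt : ∀ x ∈ L, x ≠ a → ∀ y ∈ R, y < x := by
    intro x hx hxa y hy
    by_contra hxy
    have := hLR x hx y hy
    exact hxa (hu₁ x hx y hy (by omega)).1
  have hM : ∀ x y z, Occurs (L ++ M :: R) x y z → y ∉ L ∧ y ∉ R := by
    intro x y z h
    obtain ⟨-, rfl, -⟩ := hu' x y z h
    exact ⟨fun h => (hL _ h).false, fun h => (hR _ h).false⟩
  obtain ⟨L', T, rfl⟩ := List.append_of_mem ha
  obtain rfl : T = [] := by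
    cases T with
    | nil => rfl
    | cons t T =>
      exfalso
      have hta : t ≠ a := by
        rintro rfl
        simp [List.nodup_append] at hnd
      have htc : c < t := hgt t (by simp) hta c hc
      refine (hM a t c ((occurs_append_max hL hR).mpr (Or.inr <| Or.inr <| Or.inr <| Or.inl
        ⟨?_, hc, hac, htc⟩))).1 (by simp)
      exact List.Sublist.trans (by simp) (List.sublist_append_right L' _)
  have haL' : ∀ x ∈ L', x ≠ a := by
    rintro x hx rfl
    exact (List.nodup_append.mp hnd).2.2 x hx x (by simp) rfl
  refine ⟨L', rfl, fun x y z h => ?_, fun x y z h => ?_, fun x hx => ?_, fun x hx y hy => ?_,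
    fun y hy hyc => ?_⟩
  · have h' := h.mono (List.sublist_append_left L' [a])
    exact (hM x y z ((occurs_append_max hL hR).mpr (Or.inl h'))).1 (h'.1.subset (by simp))
  · exact (hM x y z ((occurs_append_max hL hR).mpr (Or.inr <| Or.inl h))).2 (h.1.subset (by simp))
  · exact hac.trans (hgt x (by simp [hx]) (haL' x hx) c hc)
  · exact hgt x (by simp [hx]) (haL' x hx) y hy
  · by_contra hya
    have := hLR a ha y hy
    exact hyc (hu₁ a ha y hy (by omega)).2

theorem containsOnce_append_append_max {L R : List ℕ} {M a c : ℕ} (hL : ∀ x ∈ L, x < M)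
    (hR : ∀ x ∈ R, x < M) (hc : c ∈ R) (hac : a < c) (hA : Avoids L) (hA' : Avoids R)
    (haL : ∀ x ∈ L, a < x) (hLR : ∀ x ∈ L, ∀ y ∈ R, y < x) (hRa : ∀ y ∈ R, y ≠ c → y < a) :
    ContainsOnce ((L ++ [a]) ++ M :: R) := by
  have hL' : ∀ x ∈ L ++ [a], x < M := by
    intro x hx
    rcases List.mem_append.mp hx with hx | hx
    · exact hL x hx
    · obtain rfl := List.mem_singleton.mp hx
      exact hac.trans (hR c hc)
  have hcross : ∀ x ∈ L ++ [a], ∀ z ∈ R, x < z → x = a ∧ z = c := by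
    intro x hx z hz hxz
    rcases List.mem_append.mp hx with hx | hx
    · exact absurd hxz (hLR x hx z hz).not_gt
    · obtain rfl := List.mem_singleton.mp hx
      refine ⟨rfl, ?_⟩
      by_contra hzc
      exact absurd hxz (hRa z hz hzc).not_gt
  refine ⟨a, M, c, (occurs_append_max hL' hR).mpr (Or.inr <| Or.inr <| Or.inl
    ⟨by simp, rfl, hc, hac⟩), fun x y z h => ?_⟩
  rcases (occurs_append_max hL' hR).mp h with h | h | ⟨h, h₂, h', hxz⟩ | ⟨h, h', hxz, hzy⟩ |
      ⟨h, h', hxz, hzy⟩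
  · exact absurd ((occurs_append_min haL).mp h) (hA _ _ _)
  · exact absurd h (hA' _ _ _)
  · exact ⟨(hcross x h z h' hxz).1, h₂, (hcross x h z h' hxz).2⟩
  · -- `x = a` is the last letter before `M`, so nothing stands between the two
    obtain ⟨rfl, rfl⟩ := hcross x (h.subset (by simp)) z h' hxz
    rw [List.sublist_append_iff] at h
    obtain ⟨l₁, l₂, e, h₁, h₂⟩ := h
    have hx : x ∉ L := fun hx => (haL x hx).false
    rcases l₁ with _ | ⟨u, l₁⟩
    · simp at e
      subst e
      simpa using h₂.length_le
    · simp at e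
      obtain ⟨rfl, -⟩ := e
      exact absurd (h₁.subset (by simp)) hx
  · obtain ⟨rfl, rfl⟩ := hcross x h z (h'.subset (by simp)) hxz
    have hy : y ∈ R := h'.subset (by simp)
    have := hRa y hy (by omega)
    omega

/-! ### Words over a finite alphabet, split at the maximum -/

/-- The words in which every letter of `A` occurs exactly once. -/
noncomputable def words (A : Finset ℕ) : Finset (List ℕ) :=
  A.toList.permutations.toFinset

theorem mem_words {A : Finset ℕ} {l : List ℕ} :
    l ∈ words A ↔ l.Nodup ∧ ∀ x, x ∈ l ↔ x ∈ A := by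
  rw [words, List.mem_toFinset, List.mem_permutations]
  constructor
  · intro h
    exact ⟨h.nodup_iff.mpr A.nodup_toList, fun x => by rw [h.mem_iff, Finset.mem_toList]⟩
  · rintro ⟨h, h'⟩
    exact (List.perm_ext_iff_of_nodup h A.nodup_toList).mpr fun x => by rw [h', Finset.mem_toList]

theorem length_of_mem_words {A : Finset ℕ} {l : List ℕ} (h : l ∈ words A) : l.length = A.card := by
  have h' := mem_words.mp h
  rw [← List.toFinset_card_of_nodup h'.1]
  congr 1
  ext x
  simp [h'.2]

open Classical in
/-- The alternating words over `A` with first step given by `s` that avoid `1-3-2`. -/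
noncomputable def avoidSet (s : Bool) (A : Finset ℕ) : Finset (List ℕ) :=
  (words A).filter fun l => Alternates s l ∧ Avoids l

open Classical in
/-- The alternating words over `A` with first step given by `s` that contain `1-3-2` exactly
once. -/
noncomputable def onceSet (s : Bool) (A : Finset ℕ) : Finset (List ℕ) :=
  (words A).filter fun l => Alternates s l ∧ ContainsOnce l

theorem mem_avoidSet {s : Bool} {A : Finset ℕ} {l : List ℕ} :
    l ∈ avoidSet s A ↔ l ∈ words A ∧ Alternates s l ∧ Avoids l := by
  simp [avoidSet]

theorem mem_onceSet {s : Bool} {A : Finset ℕ} {l : List ℕ} :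
    l ∈ onceSet s A ↔ l ∈ words A ∧ Alternates s l ∧ ContainsOnce l := by
  simp [onceSet]

theorem exists_lower_part (A : Finset ℕ) :
    ∀ q ≤ A.card, ∃ C ⊆ A, C.card = q ∧ ∀ x ∈ A \ C, ∀ y ∈ C, y < x := by
  induction A using Finset.induction_on_max with
  | empty => intro q hq; exact ⟨∅, by simp, by simp at hq; simp [hq], by simp⟩
  | insert m A hm ih =>
    intro q hq
    have hmA : m ∉ A := fun h => (hm m h).false
    rw [Finset.card_insert_of_notMem hmA] at hq
    rcases hq.lt_or_eq with hq | rfl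
    · obtain ⟨C, hCA, hC, h⟩ := ih q (by omega)
      refine ⟨C, hCA.trans (Finset.subset_insert _ _), hC, fun x hx y hy => ?_⟩
      rw [Finset.mem_sdiff, Finset.mem_insert] at hx
      rcases hx.1 with rfl | hx'
      · exact hm y (hCA hy)
      · exact h x (Finset.mem_sdiff.mpr ⟨hx', hx.2⟩) y hy
    · exact ⟨insert m A, subset_rfl, Finset.card_insert_of_notMem hmA, by simp⟩

/-- The lower part of a finite set is determined by its number of elements. -/
theorem lower_part_unique {B C B' C' : Finset ℕ} (h : ∀ x, x ∈ B ∨ x ∈ C ↔ x ∈ B' ∨ x ∈ C')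
    (hBC : ∀ x ∈ B, ∀ y ∈ C, y < x) (hBC' : ∀ x ∈ B', ∀ y ∈ C', y < x)
    (hcard : B.card = B'.card) : B = B' ∧ C = C' := by
  have hB : B = B' := by
    by_contra hne
    obtain ⟨x, hx, hx'⟩ : ∃ x ∈ B, x ∉ B' := by
      by_contra! hsub
      exact hne (Finset.eq_of_subset_of_card_le hsub hcard.ge)
    obtain ⟨y, hy, hy'⟩ : ∃ y ∈ B', y ∉ B := by
      by_contra! hsub
      exact hne (Finset.eq_of_subset_of_card_le hsub hcard.le).symm
    have h₁ := hBC x hx y (((h y).mpr (Or.inl hy)).resolve_left hy')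
    have h₂ := hBC' y hy x (((h x).mp (Or.inl hx)).resolve_left hx')
    omega
  subst hB
  refine ⟨rfl, ?_⟩
  ext x
  have h₁ := h x
  have h₂ : x ∈ B → x ∉ C := fun hx hx' => (hBC x hx x hx').false
  have h₃ : x ∈ B → x ∉ C' := fun hx hx' => (hBC' x hx x hx').false
  tauto

/-- `M` is the maximum of `A`, and `A` without `M` is the disjoint union of the upper part `B` and
the lower part `C`. -/
structure IsSplit (A : Finset ℕ) (M : ℕ) (B C : Finset ℕ) : Prop where
  mem_iff : ∀ x, x ∈ A ↔ x = M ∨ x ∈ B ∨ x ∈ C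
  lt_left : ∀ x ∈ B, x < M
  lt_right : ∀ x ∈ C, x < M
  lt : ∀ x ∈ B, ∀ y ∈ C, y < x

theorem exists_isSplit {A : Finset ℕ} {n p : ℕ} (hA : A.card = n + 1) (hp : p ≤ n) {M : ℕ}
    (hMA : M ∈ A) (hM : ∀ x ∈ A, x ≤ M) :
    ∃ B C, IsSplit A M B C ∧ B.card = p ∧ C.card = n - p := by
  have hc : (A.erase M).card = n := by rw [Finset.card_erase_of_mem hMA, hA]; rfl
  obtain ⟨C, hC, hCc, h⟩ := exists_lower_part (A.erase M) (n - p) (by omega)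
  refine ⟨A.erase M \ C, C, ⟨fun x => ?_, fun x hx => ?_, fun x hx => ?_, h⟩, ?_, hCc⟩
  · have := @hC x
    by_cases x ∈ C <;> by_cases x = M <;> simp_all
  · have hx := Finset.mem_erase.mp (Finset.mem_sdiff.mp hx).1
    exact (hM x hx.2).lt_of_ne hx.1
  · have hx := Finset.mem_erase.mp (hC hx)
    exact (hM x hx.2).lt_of_ne hx.1
  · rw [Finset.card_sdiff_of_subset hC, hc, hCc]
    omega

/-- Splitting a word at its maximal letter. -/
theorem IsSplit.append_mem_words {A B C : Finset ℕ} {M : ℕ} (h : IsSplit A M B C)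
    {L R : List ℕ} :
    L ++ M :: R ∈ words A ↔ L.Nodup ∧ R.Nodup ∧ (∀ x ∈ L, x < M) ∧ (∀ x ∈ R, x < M) ∧
      (∀ x ∈ L, ∀ y ∈ R, x ≠ y) ∧ ∀ x, x ∈ L ∨ x ∈ R ↔ x ∈ B ∨ x ∈ C := by
  rw [mem_words]
  have hlt : ∀ x, x ∈ B ∨ x ∈ C → x < M := fun x hx => hx.elim (h.lt_left x) (h.lt_right x)
  constructor
  · rintro ⟨hnd, hmem⟩
    rw [List.nodup_append] at hnd
    obtain ⟨h₁, h₂, h₃⟩ := hnd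
    rw [List.nodup_cons] at h₂
    have hML : M ∉ L := fun hM => h₃ M hM M (by simp) rfl
    have key : ∀ x, x ∈ L ∨ x ∈ R ↔ x ∈ B ∨ x ∈ C := by
      intro x
      have h₄ := hmem x
      have h₅ := h.mem_iff x
      have h₆ := hlt x
      rw [List.mem_append, List.mem_cons] at h₄
      by_cases hx : x = M
      · subst hx
        have : ¬ (x ∈ B ∨ x ∈ C) := fun h => (h₆ h).false
        simp [hML, h₂.1, this]
      · simp only [hx, false_or] at h₄ h₅
        rw [h₄, h₅]
    exact ⟨h₁, h₂.2, fun x hx => hlt x ((key x).mp (Or.inl hx)),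
      fun x hx => hlt x ((key x).mp (Or.inr hx)), fun x hx y hy => h₃ x hx y (by simp [hy]), key⟩
  · rintro ⟨h₁, h₂, h₃, h₄, h₅, h₆⟩
    constructor
    · rw [List.nodup_append, List.nodup_cons]
      refine ⟨h₁, ⟨fun hM => (h₄ M hM).false, h₂⟩, fun x hx y hy => ?_⟩
      rcases List.mem_cons.mp hy with rfl | hy
      · exact (h₃ x hx).ne
      · exact h₅ x hx y hy
    · intro x
      have := h₆ x
      have := h.mem_iff x
      simp only [List.mem_append, List.mem_cons]
      tauto

/-- If all letters before the maximum are larger than all letters after it, the number of letters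
before the maximum determines the two alphabets. -/
theorem IsSplit.append_mem_words_of_gt {A B C : Finset ℕ} {M : ℕ} (h : IsSplit A M B C)
    {L R : List ℕ} (hL : L.length = B.card) :
    (L ++ M :: R ∈ words A ∧ ∀ x ∈ L, ∀ y ∈ R, y < x) ↔ L ∈ words B ∧ R ∈ words C := by
  rw [h.append_mem_words]
  constructor
  · rintro ⟨⟨h₁, h₂, -, -, -, h₆⟩, h₇⟩
    obtain ⟨hB, hC⟩ := lower_part_unique (B := L.toFinset) (C := R.toFinset) (B' := B) (C' := C)
      (by simpa using h₆) (by simpa using h₇) h.lt (by rw [List.toFinset_card_of_nodup h₁, hL])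
    exact ⟨mem_words.mpr ⟨h₁, by simp [← hB]⟩, mem_words.mpr ⟨h₂, by simp [← hC]⟩⟩
  · rintro ⟨h₁, h₂⟩
    rw [mem_words] at h₁ h₂
    have hlt : ∀ x ∈ L, ∀ y ∈ R, y < x := fun x hx y hy =>
      h.lt x ((h₁.2 x).mp hx) y ((h₂.2 y).mp hy)
    exact ⟨⟨h₁.1, h₂.1, fun x hx => h.lt_left x ((h₁.2 x).mp hx),
      fun x hx => h.lt_right x ((h₂.2 x).mp hx), fun x hx y hy => (hlt x hx y hy).ne',
      fun x => by rw [h₁.2, h₂.2]⟩, hlt⟩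

theorem idxOf_append_cons {L R : List ℕ} {M : ℕ} (h : M ∉ L) :
    (L ++ M :: R).idxOf M = L.length := by
  rw [List.idxOf_append_of_notMem h, List.idxOf_cons_self, add_zero]

/-- The words of a set of words in which the letter `M` is at the position `p` are counted by
the pairs of the subwords before and after `M`. -/
theorem card_filter_idxOf_eq {S : Finset (List ℕ)} {M p : ℕ} {T : Finset (List ℕ × List ℕ)}
    (hS : ∀ l ∈ S, M ∈ l) (hS' : ∀ L R, L ++ M :: R ∈ S → M ∉ L)
    (h : ∀ L R, (L, R) ∈ T ↔ L ++ M :: R ∈ S ∧ L.length = p) :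
    (S.filter fun l => l.idxOf M = p).card = T.card := by
  symm
  refine Finset.card_bij (fun t _ => t.1 ++ M :: t.2) ?_ ?_ ?_
  · rintro ⟨L, R⟩ ht
    have ht := (h L R).mp ht
    rw [Finset.mem_filter, idxOf_append_cons (hS' L R ht.1)]
    exact ht
  · rintro ⟨L, R⟩ ht ⟨L', R'⟩ ht' he
    have ht := (h L R).mp ht
    have ht' := (h L' R').mp ht'
    obtain ⟨h₁, h₂⟩ := List.append_inj he (ht.2.trans ht'.2.symm)
    simp_all
  · intro l hl
    rw [Finset.mem_filter] at hl
    obtain ⟨L, R, rfl⟩ := List.append_of_mem (hS l hl.1)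
    refine ⟨(L, R), (h L R).mpr ⟨hl.1, ?_⟩, rfl⟩
    rw [← hl.2, idxOf_append_cons (hS' L R hl.1)]

/-! ### Avoiding words -/

theorem IsSplit.append_mem_avoidSet {A B C : Finset ℕ} {M : ℕ} (h : IsSplit A M B C)
    {s : Bool} (hs : B.card.bodd = s) {L R : List ℕ} :
    (L, R) ∈ avoidSet s B ×ˢ avoidSet true C ↔
      L ++ M :: R ∈ avoidSet s A ∧ L.length = B.card := by
  rw [Finset.mem_product, mem_avoidSet, mem_avoidSet, mem_avoidSet]
  constructor
  · rintro ⟨⟨h₁, h₂, h₃⟩, h₄, h₅, h₆⟩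
    have hlen := length_of_mem_words h₁
    have hw := (h.append_mem_words_of_gt hlen).mpr ⟨h₁, h₄⟩
    obtain ⟨-, -, hL, hR, hLR, -⟩ := h.append_mem_words.mp hw.1
    exact ⟨⟨hw.1, (alternates_append_max hR s hL).mpr ⟨h₂, h₅, fun _ => by rw [hlen, hs]⟩,
      (avoids_append_max hL hR hLR).mpr ⟨h₃, h₆, hw.2⟩⟩, hlen⟩
  · rintro ⟨⟨h₁, h₂, h₃⟩, hlen⟩
    obtain ⟨-, -, hL, hR, hLR, -⟩ := h.append_mem_words.mp h₁
    obtain ⟨a₁, a₂, -⟩ := (alternates_append_max hR s hL).mp h₂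
    obtain ⟨b₁, b₂, b₃⟩ := (avoids_append_max hL hR hLR).mp h₃
    obtain ⟨w₁, w₂⟩ := (h.append_mem_words_of_gt hlen).mp ⟨h₁, b₃⟩
    exact ⟨⟨w₁, a₁, b₁⟩, w₂, a₂, b₂⟩

/-- In an alternating word of length at least `2`, the parity of the position of the maximum is
determined by the first step. -/
theorem bodd_idxOf_max {A : Finset ℕ} {M : ℕ} (hMA : M ∈ A) (hM : ∀ x ∈ A, x ≤ M)
    (hA : 2 ≤ A.card) {s : Bool} {l : List ℕ} (hl : l ∈ words A) (hs : Alternates s l) :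
    (l.idxOf M).bodd = s := by
  have hlen := length_of_mem_words hl
  obtain ⟨hnd, hmem⟩ := mem_words.mp hl
  obtain ⟨L, R, rfl⟩ := List.append_of_mem ((hmem M).mpr hMA)
  have hlt : ∀ x ∈ L ++ R, x < M := by
    intro x hx
    refine (hM x ((hmem x).mp (by simp at hx ⊢; tauto))).lt_of_ne ?_
    rintro rfl
    rw [List.nodup_middle, List.nodup_cons] at hnd
    exact hnd.1 hx
  rw [idxOf_append_cons (fun h => (hlt M (by simp [h])).false)]
  refine ((alternates_append_max (fun x hx => hlt x (by simp [hx])) s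
    (fun x hx => hlt x (by simp [hx]))).mp hs).2.2 ?_
  simp at hlen
  omega

theorem idxOf_mem_range {A : Finset ℕ} {M n : ℕ} (hMA : M ∈ A) (hA : A.card = n)
    {l : List ℕ} (hl : l ∈ words A) : l.idxOf M ∈ Finset.range n := by
  rw [Finset.mem_range, ← hA, ← length_of_mem_words hl]
  exact List.idxOf_lt_length_of_mem (((mem_words.mp hl).2 M).mpr hMA)

/-- The number of alternating `1-3-2` avoiding words of length `n` with first step given
by `s`. -/
def avoidNum (s : Bool) (n : ℕ) : ℕ :=
  catalan ((n + (!s).toNat) / 2)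

/-- The terms of a given parity in a sum over `0, …, 2m - 1`. -/
theorem sum_range_bodd (f : ℕ → ℕ) (s : Bool) (m : ℕ) :
    (∑ p ∈ Finset.range (2 * m), if p.bodd = s then f p else 0) =
      ∑ i ∈ Finset.range m, f (2 * i + s.toNat) := by
  induction m with
  | zero => simp
  | succ m ih =>
    rw [show 2 * (m + 1) = 2 * m + 1 + 1 by ring, Finset.sum_range_succ, Finset.sum_range_succ, ih,
      Finset.sum_range_succ]
    cases s <;> simp

theorem avoidNum_succ (s : Bool) {n : ℕ} (hn : n ≠ 0) :
    avoidNum s (n + 1) = ∑ p ∈ Finset.range (n + 1),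
      if p.bodd = s then avoidNum s p * avoidNum true (n - p) else 0 := by
  obtain ⟨m, rfl | rfl⟩ := n.even_or_odd'
  · rw [Finset.sum_range_succ, sum_range_bodd]
    obtain ⟨m, rfl⟩ : ∃ k, m = k + 1 := ⟨m - 1, by omega⟩
    cases s
    · rw [show avoidNum false (2 * (m + 1) + 1) = catalan (m + 1 + 1) by
        simp [avoidNum]; congr 1; omega, catalan_succ, Fin.sum_univ_eq_sum_range
        (fun i => catalan i * catalan (m + 1 - i)), Finset.sum_range_succ]
      congr 1
      · refine Finset.sum_congr rfl fun i hi => ?_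
        rw [Finset.mem_range] at hi
        simp [avoidNum]
        congr 2 <;> omega
      · simp [avoidNum]
        congr 1; omega
    · rw [show avoidNum true (2 * (m + 1) + 1) = catalan (m + 1) by
        simp [avoidNum]; congr 1; omega, catalan_succ, Fin.sum_univ_eq_sum_range
        (fun i => catalan i * catalan (m - i))]
      simp only [Nat.bodd_mul, Nat.bodd_two, Bool.false_and, reduceCtorEq, if_false, add_zero]
      refine Finset.sum_congr rfl fun i hi => ?_
      rw [Finset.mem_range] at hi
      simp [avoidNum]
      congr 2 <;> omega
  · rw [show 2 * m + 1 + 1 = 2 * (m + 1) by ring, sum_range_bodd]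
    have : avoidNum s (2 * (m + 1)) = catalan (m + 1) := by
      cases s <;> (simp [avoidNum]; try (congr 1; omega))
    rw [this, catalan_succ, Fin.sum_univ_eq_sum_range (fun i => catalan i * catalan (m - i))]
    refine Finset.sum_congr rfl fun i hi => ?_
    rw [Finset.mem_range] at hi
    cases s <;> (simp [avoidNum]; congr 2 <;> omega)

theorem exists_max_of_card {A : Finset ℕ} {n : ℕ} (hA : A.card = n + 1) :
    ∃ M ∈ A, ∀ x ∈ A, x ≤ M :=
  A.exists_max_image id (Finset.card_pos.mp (by omega))

theorem alternates_avoids_of_length_le_one {l : List ℕ} (hl : l.length ≤ 1) (s : Bool) :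
    Alternates s l ∧ Avoids l := by
  constructor
  · match l with
    | [] => trivial
    | [_] => trivial
    | _ :: _ :: _ => simp at hl
  · rintro a b c ⟨h, -⟩
    have := h.length_le
    simp at this
    omega

theorem card_avoidSet (n : ℕ) : ∀ (s : Bool) (A : Finset ℕ), A.card = n →
    (avoidSet s A).card = avoidNum s n := by
  induction n using Nat.strong_induction_on with
  | _ n ih =>
  intro s A hA
  by_cases hn : n ≤ 1
  · have h₁ : avoidSet s A = words A := by
      ext l
      rw [mem_avoidSet, and_iff_left_iff_imp]
      intro hl
      exact alternates_avoids_of_length_le_one (by rw [length_of_mem_words hl]; omega) s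
    have h₂ : (words A).card = 1 := by
      interval_cases n
      · rw [Finset.card_eq_zero] at hA
        subst hA
        simp [words]
      · rw [Finset.card_eq_one] at hA
        obtain ⟨a, rfl⟩ := hA
        rw [Finset.card_eq_one]
        refine ⟨[a], ?_⟩
        ext l
        rw [Finset.mem_singleton]
        constructor
        · intro hl
          obtain ⟨b, rfl⟩ := List.length_eq_one_iff.mp (by simpa using length_of_mem_words hl)
          have := ((mem_words.mp hl).2 a).mpr (by simp)
          simp_all
        · rintro rfl
          exact mem_words.mpr (by simp)
    rw [h₁, h₂]
    interval_cases n <;> cases s <;> simp [avoidNum]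
  · obtain ⟨n, rfl⟩ : ∃ k, n = k + 1 := ⟨n - 1, by omega⟩
    obtain ⟨M, hMA, hM⟩ := exists_max_of_card hA
    rw [avoidNum_succ s (by omega), Finset.card_eq_sum_card_fiberwise (f := fun l => l.idxOf M)
      (t := Finset.range (n + 1))
      (fun l hl => by exact idxOf_mem_range hMA hA (mem_avoidSet.mp hl).1)]
    refine Finset.sum_congr rfl fun p hp => ?_
    rw [Finset.mem_range] at hp
    split_ifs with hs
    · obtain ⟨B, C, hsp, hB, hC⟩ := exists_isSplit hA (by omega : p ≤ n) hMA hM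
      rw [card_filter_idxOf_eq (T := avoidSet s B ×ˢ avoidSet true C), Finset.card_product,
        ih p (by omega) s B hB, ih (n - p) (by omega) true C hC]
      · exact fun l hl => ((mem_words.mp (mem_avoidSet.mp hl).1).2 M).mpr hMA
      · exact fun L R hl hML => ((hsp.append_mem_words.mp (mem_avoidSet.mp hl).1).2.2.1 M hML).false
      · intro L R
        rw [← hB]
        exact hsp.append_mem_avoidSet (by rw [hB, hs])
    · rw [Finset.card_eq_zero, Finset.filter_eq_empty_iff]
      intro l hl hlp
      rw [mem_avoidSet] at hl
      exact hs (hlp ▸ bodd_idxOf_max hMA hM (by omega) hl.1 hl.2.1)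

/-! ### Words containing the pattern exactly once -/

/-- The pairs of words `(L, R)` such that `L ++ M :: R` has one occurrence of `1-3-2`, whose
`3` is the maximum `M`: it uses the last letter `a` of `L`. Compared with the upper part `B` and
the lower part `C` of the alphabet, the maximum `a` of `C` and the minimum of `B` have changed
sides. -/
noncomputable def crossPairs (s : Bool) (B C : Finset ℕ) (a c : ℕ) : Finset (List ℕ × List ℕ) :=
  (avoidSet s (B.erase c) ×ˢ avoidSet true (insert c (C.erase a))).image
    fun t => (t.1 ++ [a], t.2)

theorem mem_crossPairs {s : Bool} {B C : Finset ℕ} {a c : ℕ} {L R : List ℕ} :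
    (L, R) ∈ crossPairs s B C a c ↔ ∃ L', L = L' ++ [a] ∧ L' ∈ avoidSet s (B.erase c) ∧
      R ∈ avoidSet true (insert c (C.erase a)) := by
  simp only [crossPairs, Finset.mem_image, Finset.mem_product, Prod.mk.injEq, Prod.exists]
  constructor
  · rintro ⟨L', R', ⟨h₁, h₂⟩, rfl, rfl⟩
    exact ⟨L', rfl, h₁, h₂⟩
  · rintro ⟨L', rfl, h₁, h₂⟩
    exact ⟨L', R, ⟨h₁, h₂⟩, rfl, rfl⟩

theorem card_crossPairs {s : Bool} {B C : Finset ℕ} {a c : ℕ} (ha : a ∈ C) (hc : c ∈ B)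
    (hcC : c ∉ C) :
    (crossPairs s B C a c).card = avoidNum s (B.card - 1) * avoidNum true C.card := by
  rw [crossPairs, Finset.card_image_of_injective, Finset.card_product,
    card_avoidSet (B.card - 1) s _ (Finset.card_erase_of_mem hc), card_avoidSet C.card true]
  · rw [Finset.card_insert_of_notMem (fun h => hcC (Finset.mem_of_mem_erase h)),
      Finset.card_erase_add_one ha]
  · rintro ⟨L, R⟩ ⟨L', R'⟩ h
    simpa using h

theorem IsSplit.mem_crossPairs_of_mem_onceSet {A B C : Finset ℕ} {M : ℕ} (h : IsSplit A M B C)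
    {s : Bool} {L R : List ℕ} (hl : L ++ M :: R ∈ onceSet s A)
    (hlen : L.length = B.card) (hLR : ¬ ∀ x ∈ L, ∀ y ∈ R, y < x) :
    ∃ a ∈ C, ∃ c ∈ B, (∀ y ∈ C, y ≤ a) ∧ (∀ x ∈ B, c ≤ x) ∧ (L, R) ∈ crossPairs s B C a c := by
  obtain ⟨hw, halt, honce⟩ := mem_onceSet.mp hl
  obtain ⟨hLnd, hRnd, hLM, hRM, hne, hmem⟩ := h.append_mem_words.mp hw
  push Not at hLR
  obtain ⟨a, ha, c, hc, hac⟩ := hLR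
  have hac : a < c := hac.lt_of_ne (hne a ha c hc)
  obtain ⟨L', rfl, hA, hA', haL', hL'R, hRa⟩ :=
    containsOnce_append_max_of_lt hLM hRM hne hLnd ha hc hac honce
  have hcL' : c ∉ L' := fun hcL' => hne c (by simp [hcL']) c hc rfl
  have haR : a ∉ R := fun haR => hne a ha a haR rfl
  have haL'' : a ∉ L' := fun h => (haL' a h).false
  have hL'nd : L'.Nodup := hLnd.sublist (List.sublist_append_left _ _)
  -- exchanging `a` and `c` gives the splitting of the alphabet
  obtain ⟨hB, hC⟩ := lower_part_unique (B := insert c L'.toFinset)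
    (C := insert a (R.toFinset.erase c)) (B' := B) (C' := C)
    (by
      intro x
      rw [← hmem x]
      simp only [Finset.mem_insert, List.mem_toFinset, Finset.mem_erase, List.mem_append,
        List.mem_singleton]
      by_cases hxc : x = c
      · subst hxc; simp [hc]
      · simp [hxc]; tauto)
    (by
      intro x hx y hy
      simp only [Finset.mem_insert, List.mem_toFinset, Finset.mem_erase] at hx hy
      rcases hx with rfl | hx <;> rcases hy with rfl | hy
      · exact hac
      · exact (hRa y hy.2 hy.1).trans hac
      · exact haL' x hx
      · exact hL'R x hx y hy.2)
    h.lt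
    (by
      rw [Finset.card_insert_of_notMem (by simpa using hcL'), List.toFinset_card_of_nodup hL'nd,
        ← hlen]
      simp)
  have halt' := (alternates_append_max hRM s hLM).mp halt
  refine ⟨a, by simp [← hC], c, by simp [← hB], fun y hy => ?_, fun x hx => ?_,
    mem_crossPairs.mpr ⟨L', rfl, mem_avoidSet.mpr ⟨mem_words.mpr ⟨hL'nd, fun x => ?_⟩,
      ((alternates_append_min s haL').mp halt'.1).1, hA⟩,
      mem_avoidSet.mpr ⟨mem_words.mpr ⟨hRnd, fun x => ?_⟩, halt'.2.1, hA'⟩⟩⟩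
  · rw [← hC] at hy
    simp only [Finset.mem_insert, List.mem_toFinset, Finset.mem_erase] at hy
    rcases hy with rfl | hy
    · exact le_rfl
    · exact (hRa y hy.2 hy.1).le
  · rw [← hB] at hx
    simp only [Finset.mem_insert, List.mem_toFinset] at hx
    rcases hx with rfl | hx
    · exact le_rfl
    · exact (hL'R x hx c hc).le
  · rw [← hB, Finset.erase_insert (by simpa using hcL'), List.mem_toFinset]
  · rw [← hC, Finset.erase_insert (by simp [haR]), Finset.insert_erase (by simpa using hc),
      List.mem_toFinset]

theorem IsSplit.mem_onceSet_of_mem_crossPairs {A B C : Finset ℕ} {M : ℕ} (h : IsSplit A M B C)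
    {s : Bool} (hs : B.card.bodd = s) {a c : ℕ} (ha : a ∈ C) (hc : c ∈ B) (ha' : ∀ y ∈ C, y ≤ a)
    (hc' : ∀ x ∈ B, c ≤ x) {L R : List ℕ} (hl : (L, R) ∈ crossPairs s B C a c) :
    L ++ M :: R ∈ onceSet s A ∧ L.length = B.card := by
  obtain ⟨L, rfl, hL, hR⟩ := mem_crossPairs.mp hl
  obtain ⟨hLw, hLalt, hLav⟩ := mem_avoidSet.mp hL
  obtain ⟨hRw, hRalt, hRav⟩ := mem_avoidSet.mp hR
  have hlen : L.length + 1 = B.card := by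
    rw [length_of_mem_words hLw, Finset.card_erase_add_one hc]
  have hac := h.lt c hc a ha
  have hLB : ∀ x ∈ L, x ∈ B ∧ x ≠ c := fun x hx => by
    have := ((mem_words.mp hLw).2 x).mp hx
    simp_all
  have hRC : ∀ y ∈ R, y ≠ c → y ∈ C ∧ y ≠ a := fun y hy hyc => by
    have := ((mem_words.mp hRw).2 y).mp hy
    simp_all
  have hcR : c ∈ R := ((mem_words.mp hRw).2 c).mpr (by simp)
  have hLM : ∀ x ∈ L, x < M := fun x hx => h.lt_left x (hLB x hx).1
  have haL : ∀ x ∈ L, a < x := fun x hx => h.lt x (hLB x hx).1 a ha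
  have hRM : ∀ y ∈ R, y < M := fun y hy => by
    by_cases hyc : y = c
    · exact hyc ▸ h.lt_left c hc
    · exact h.lt_right y (hRC y hy hyc).1
  have hLR : ∀ x ∈ L, ∀ y ∈ R, y < x := fun x hx y hy => by
    by_cases hyc : y = c
    · exact hyc ▸ (hc' x (hLB x hx).1).lt_of_ne' (hLB x hx).2
    · exact h.lt x (hLB x hx).1 y (hRC y hy hyc).1
  have hRa : ∀ y ∈ R, y ≠ c → y < a := fun y hy hyc =>
    (ha' y (hRC y hy hyc).1).lt_of_ne (hRC y hy hyc).2
  have hLM' : ∀ x ∈ L ++ [a], x < M := by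
    intro x hx
    rcases List.mem_append.mp hx with hx | hx
    · exact hLM x hx
    · obtain rfl := List.mem_singleton.mp hx
      exact h.lt_right x ha
  refine ⟨mem_onceSet.mpr ⟨h.append_mem_words.mpr ⟨?_, (mem_words.mp hRw).1, hLM', hRM, ?_, ?_⟩,
    (alternates_append_max hRM s hLM').mpr ⟨(alternates_append_min s haL).mpr ⟨hLalt, fun _ => ?_⟩,
      hRalt, fun _ => ?_⟩,
    containsOnce_append_append_max hLM hRM hcR hac hLav hRav haL hLR hRa⟩, by simpa using hlen⟩
  · rw [List.nodup_append]
    refine ⟨(mem_words.mp hLw).1, by simp, fun x hx y hy => ?_⟩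
    obtain rfl := List.mem_singleton.mp hy
    exact (haL x hx).ne'
  · intro x hx y hy
    rcases List.mem_append.mp hx with hx | hx
    · exact (hLR x hx y hy).ne'
    · obtain rfl := List.mem_singleton.mp hx
      by_cases hyc : y = c
      · exact hyc ▸ hac.ne
      · exact (hRC y hy hyc).2.symm
  · intro x
    simp only [List.mem_append, List.mem_singleton, (mem_words.mp hLw).2, (mem_words.mp hRw).2,
      Finset.mem_insert, Finset.mem_erase]
    by_cases hxa : x = a
    · subst hxa; simp [ha]
    · by_cases hxc : x = c
      · subst hxc; simp [hc]
      · simp [hxa, hxc]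
  · rw [← hs, ← hlen, Nat.bodd_succ, Bool.not_not]
  · rw [List.length_append, List.length_singleton, hlen, hs]

theorem IsSplit.append_mem_onceSet_of_gt {A B C : Finset ℕ} {M : ℕ} (h : IsSplit A M B C)
    {s : Bool} (hs : B.card.bodd = s) {L R : List ℕ} :
    (L ++ M :: R ∈ onceSet s A ∧ L.length = B.card) ∧ (∀ x ∈ L, ∀ y ∈ R, y < x) ↔
      (L ∈ onceSet s B ∧ R ∈ avoidSet true C) ∨ (L ∈ avoidSet s B ∧ R ∈ onceSet true C) := by
  simp only [mem_avoidSet, mem_onceSet]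
  constructor
  · rintro ⟨⟨⟨h₁, h₂, h₃⟩, hlen⟩, hlt⟩
    obtain ⟨-, -, hL, hR, -, -⟩ := h.append_mem_words.mp h₁
    obtain ⟨a₁, a₂, -⟩ := (alternates_append_max hR s hL).mp h₂
    obtain ⟨w₁, w₂⟩ := (h.append_mem_words_of_gt hlen).mp ⟨h₁, hlt⟩
    have := (containsOnce_append_max_of_gt hL hR hlt).mp h₃
    tauto
  · intro hh
    have w₁ : L ∈ words B := by tauto
    have w₂ : R ∈ words C := by tauto
    have hlen := length_of_mem_words w₁
    obtain ⟨hw, hlt⟩ := (h.append_mem_words_of_gt hlen).mpr ⟨w₁, w₂⟩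
    obtain ⟨-, -, hL, hR, -, -⟩ := h.append_mem_words.mp hw
    refine ⟨⟨⟨hw, (alternates_append_max hR s hL).mpr
      ⟨by tauto, by tauto, fun _ => by rw [hlen, hs]⟩,
      (containsOnce_append_max_of_gt hL hR hlt).mpr (by tauto)⟩, hlen⟩, hlt⟩

/-- An avoiding word contains no occurrence, let alone exactly one. -/
theorem disjoint_onceSet_avoidSet (s : Bool) (A : Finset ℕ) :
    Disjoint (onceSet s A) (avoidSet s A) := by
  rw [Finset.disjoint_left]
  intro l h h'
  obtain ⟨a, b, c, ho, -⟩ := (mem_onceSet.mp h).2.2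
  exact (mem_avoidSet.mp h').2.2 a b c ho

theorem card_onceSet_filter {A B C : Finset ℕ} {M : ℕ} (h : IsSplit A M B C)
    {s : Bool} (hs : B.card.bodd = s) :
    ((onceSet s A).filter fun l => l.idxOf M = B.card).card =
      (onceSet s B).card * avoidNum true C.card + avoidNum s B.card * (onceSet true C).card +
        if B.card ≠ 0 ∧ C.card ≠ 0 then avoidNum s (B.card - 1) * avoidNum true C.card else 0 := by
  have hMl : ∀ l ∈ onceSet s A, M ∈ l := fun l hl =>
    ((mem_words.mp (mem_onceSet.mp hl).1).2 M).mpr ((h.mem_iff M).mpr (Or.inl rfl))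
  have hML : ∀ L R, L ++ M :: R ∈ onceSet s A → M ∉ L := fun L R hl hML =>
    ((h.append_mem_words.mp (mem_onceSet.mp hl).1).2.2.1 M hML).false
  have hcard : (onceSet s B ×ˢ avoidSet true C ∪ avoidSet s B ×ˢ onceSet true C).card =
      (onceSet s B).card * avoidNum true C.card + avoidNum s B.card * (onceSet true C).card := by
    rw [Finset.card_union_of_disjoint, Finset.card_product, Finset.card_product,
      card_avoidSet _ _ _ rfl, card_avoidSet _ _ _ rfl]
    exact Finset.disjoint_product.mpr (Or.inl (disjoint_onceSet_avoidSet s B))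
  split_ifs with hBC
  · obtain ⟨c, hc, hc'⟩ := B.exists_min_image id (Finset.card_ne_zero.mp hBC.1)
    obtain ⟨a, ha, ha'⟩ := C.exists_max_image id (Finset.card_ne_zero.mp hBC.2)
    have hcC : c ∉ C := fun hcC => (h.lt c hc c hcC).false
    have haB : a ∉ B := fun haB => (h.lt a haB a ha).false
    rw [card_filter_idxOf_eq (T := (onceSet s B ×ˢ avoidSet true C ∪
      avoidSet s B ×ˢ onceSet true C) ∪ crossPairs s B C a c) hMl hML,
      Finset.card_union_of_disjoint, hcard, card_crossPairs ha hc hcC]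
    · rw [Finset.disjoint_left]
      rintro ⟨L, R⟩ h₁ h₂
      obtain ⟨L, rfl, -⟩ := mem_crossPairs.mp h₂
      simp only [Finset.mem_union, Finset.mem_product, mem_onceSet, mem_avoidSet] at h₁
      have : L ++ [a] ∈ words B := by tauto
      exact haB (((mem_words.mp this).2 a).mp (by simp))
    · intro L R
      rw [Finset.mem_union, Finset.mem_union, Finset.mem_product, Finset.mem_product,
        ← h.append_mem_onceSet_of_gt hs]
      constructor
      · rintro (h₁ | h₁)
        · exact h₁.1
        · exact h.mem_onceSet_of_mem_crossPairs hs ha hc ha' hc' h₁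
      · intro h₁
        by_cases hlt : ∀ x ∈ L, ∀ y ∈ R, y < x
        · exact Or.inl ⟨h₁, hlt⟩
        · obtain ⟨a₁, ha₁, c₁, hc₁, h₂, h₃, h₄⟩ :=
            h.mem_crossPairs_of_mem_onceSet h₁.1 h₁.2 hlt
          obtain rfl : a = a₁ := le_antisymm (h₂ a ha) (ha' a₁ ha₁)
          obtain rfl : c = c₁ := le_antisymm (hc' c₁ hc₁) (h₃ c hc)
          exact Or.inr h₄
  · rw [card_filter_idxOf_eq (T := onceSet s B ×ˢ avoidSet true C ∪
      avoidSet s B ×ˢ onceSet true C) hMl hML, hcard, add_zero]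
    intro L R
    rw [Finset.mem_union, Finset.mem_product, Finset.mem_product, ← h.append_mem_onceSet_of_gt hs,
      and_iff_left_iff_imp]
    intro h₁
    by_contra hlt
    obtain ⟨a₁, ha₁, c₁, hc₁, -⟩ := h.mem_crossPairs_of_mem_onceSet h₁.1 h₁.2 hlt
    exact hBC ⟨Finset.card_ne_zero_of_mem hc₁, Finset.card_ne_zero_of_mem ha₁⟩

/-- The number of alternating words of length `n` with first step given by `s` that contain
`1-3-2` exactly once. -/
noncomputable def onceNum (s : Bool) (n : ℕ) : ℕ :=
  (onceSet s (Finset.range n)).card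

theorem onceSet_eq_empty {A : Finset ℕ} (hA : A.card ≤ 2) (s : Bool) : onceSet s A = ∅ := by
  rw [Finset.eq_empty_iff_forall_notMem]
  intro l hl
  obtain ⟨hw, -, a, b, c, ⟨h, -⟩, -⟩ := mem_onceSet.mp hl
  have h₁ := h.length_le
  rw [length_of_mem_words hw] at h₁
  simp at h₁
  omega

/-- The summand of the recurrence for `onceNum`, in which `p` letters stand before the maximum
and `q` letters after it. The last term is for an occurrence that uses the maximum. -/
noncomputable def onceTerm (s : Bool) (p q : ℕ) : ℕ :=
  onceNum s p * avoidNum true q + avoidNum s p * onceNum true q +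
    if p ≠ 0 ∧ q ≠ 0 then avoidNum s (p - 1) * avoidNum true q else 0

theorem card_onceSet_of_forall_lt {n : ℕ} (s : Bool) {A : Finset ℕ} (hA : A.card = n + 1)
    (ih : ∀ k ≤ n, ∀ (s : Bool) (B : Finset ℕ), B.card = k → (onceSet s B).card = onceNum s k) :
    (onceSet s A).card =
      ∑ p ∈ Finset.range (n + 1), if p.bodd = s then onceTerm s p (n - p) else 0 := by
  by_cases hn : n = 0
  · subst hn
    have h₀ : ∀ s, onceNum s 0 = 0 := fun s => by
      rw [onceNum, onceSet_eq_empty (by simp), Finset.card_empty]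
    rw [onceSet_eq_empty (by omega)]
    cases s <;> simp [onceTerm, h₀]
  obtain ⟨M, hMA, hM⟩ := exists_max_of_card hA
  rw [Finset.card_eq_sum_card_fiberwise (f := fun l => l.idxOf M) (t := Finset.range (n + 1))
    (fun l hl => by exact idxOf_mem_range hMA hA (mem_onceSet.mp hl).1)]
  refine Finset.sum_congr rfl fun p hp => ?_
  rw [Finset.mem_range] at hp
  by_cases hs : p.bodd = s
  · obtain ⟨B, C, hsp, rfl, hC⟩ := exists_isSplit hA (by omega : p ≤ n) hMA hM
    rw [if_pos hs, card_onceSet_filter hsp hs, ih _ (by omega) s B rfl,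
      ih _ (by omega) true C hC, hC, onceTerm]
  · rw [if_neg hs, Finset.card_eq_zero, Finset.filter_eq_empty_iff]
    intro l hl hlp
    rw [mem_onceSet] at hl
    exact hs (hlp ▸ bodd_idxOf_max hMA hM (by omega) hl.1 hl.2.1)

theorem card_onceSet (n : ℕ) : ∀ (s : Bool) (A : Finset ℕ), A.card = n →
    (onceSet s A).card = onceNum s n := by
  induction n using Nat.strong_induction_on with
  | _ n ih =>
  intro s A hA
  cases n with
  | zero => rw [onceSet_eq_empty (by omega), onceNum, onceSet_eq_empty (by simp)]
  | succ n =>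
    have ih' := fun k (hk : k ≤ n) => ih k (by omega)
    rw [onceNum, card_onceSet_of_forall_lt s hA ih',
      card_onceSet_of_forall_lt s (Finset.card_range _) ih']

theorem onceNum_succ (s : Bool) (n : ℕ) :
    onceNum s (n + 1) =
      ∑ p ∈ Finset.range (n + 1), if p.bodd = s then onceTerm s p (n - p) else 0 :=
  card_onceSet_of_forall_lt s (Finset.card_range _) fun k _ => card_onceSet k

/-! ### Generating functions -/

open PowerSeries

/-- The Catalan series over `ℚ`. -/
noncomputable def catSeries : ℚ⟦X⟧ :=
  PowerSeries.map (Nat.castRingHom ℚ) catalanSeries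

/-- The generating function, in powers of `x²`, of the numbers `onceNum s (2m + r)`. -/
noncomputable def onceSeries (s : Bool) (r : ℕ) : ℚ⟦X⟧ :=
  PowerSeries.mk fun m => (onceNum s (2 * m + r) : ℚ)

/-- The generating function of the central binomial coefficients. -/
noncomputable def centralSeries : ℚ⟦X⟧ :=
  PowerSeries.mk fun m => (m.centralBinom : ℚ)

theorem coeff_catSeries (m : ℕ) : coeff m catSeries = (catalan m : ℚ) := by
  simp [catSeries]

theorem coeff_catSeries_sub_one (m : ℕ) :
    coeff m (catSeries - 1) = ((if m = 0 then 0 else catalan m : ℕ) : ℚ) := by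
  rw [map_sub, coeff_catSeries, coeff_one]
  split_ifs with h
  · simp [h]
  · simp

theorem coeff_onceSeries (s : Bool) (r m : ℕ) :
    coeff m (onceSeries s r) = (onceNum s (2 * m + r) : ℚ) := by
  simp [onceSeries]

theorem catSeries_eq : catSeries = 1 + X * catSeries ^ 2 := by
  have h := congrArg (PowerSeries.map (Nat.castRingHom ℚ)) catalanSeries_sq_mul_X_add_one
  simp only [map_add, map_mul, map_pow, map_X, map_one] at h
  unfold catSeries
  linear_combination -h

/-- `∑ (2m choose m) yᵐ` is the derivative of `G = y C(y)`; differentiating `G = y + G²` shows that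
its inverse is `1 - 2G = √(1 - 4y)`. -/
theorem centralSeries_mul : centralSeries * (1 - 2 * X * catSeries) = 1 := by
  have h₁ : centralSeries = d⁄dX ℚ (X * catSeries) := by
    ext m
    rw [coeff_derivative, coeff_succ_X_mul, coeff_catSeries, centralSeries, coeff_mk,
      ← succ_mul_catalan_eq_centralBinom]
    push_cast
    ring
  have h₂ : X * catSeries = X + (X * catSeries) * (X * catSeries) := by
    linear_combination X * catSeries_eq
  have h₃ := congrArg (d⁄dX ℚ) h₂
  rw [map_add, Derivation.leibniz _ (X * catSeries) (X * catSeries), derivative_X, ← h₁] at h₃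
  simp only [smul_eq_mul] at h₃
  linear_combination h₃

theorem coeff_mul_range (f g : ℚ⟦X⟧) (m : ℕ) :
    coeff m (f * g) = ∑ i ∈ Finset.range (m + 1), coeff i f * coeff (m - i) g := by
  rw [coeff_mul, Finset.Nat.sum_antidiagonal_eq_sum_range_succ_mk]

theorem onceNum_eq_zero {n : ℕ} (hn : n ≤ 2) (s : Bool) : onceNum s n = 0 := by
  rw [onceNum, onceSet_eq_empty (by simpa using hn), Finset.card_empty]

theorem onceNum_true_odd (m : ℕ) :
    onceNum true (2 * (m + 1) + 1) = ∑ i ∈ Finset.range (m + 1),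
      (onceNum true (2 * i + 1) * catalan (m - i) + catalan i * onceNum true (2 * (m - i) + 1) +
        catalan i * catalan (m - i)) := by
  rw [onceNum_succ, Finset.sum_range_succ, sum_range_bodd]
  simp only [Nat.bodd_mul, Nat.bodd_two, Bool.false_and, reduceCtorEq, if_false, add_zero]
  refine Finset.sum_congr rfl fun i hi => ?_
  rw [Finset.mem_range] at hi
  have h : 2 * (m + 1) - (2 * i + true.toNat) = 2 * (m - i) + 1 := by simp; omega
  have h₁ : (2 * i + 1) / 2 = i := by omega
  have h₂ : (2 * (m - i) + 1) / 2 = m - i := by omega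
  rw [h]
  simp [onceTerm, avoidNum, h₁, h₂]

theorem onceNum_true_even (m : ℕ) :
    onceNum true (2 * (m + 1)) = ∑ i ∈ Finset.range (m + 1),
      (onceNum true (2 * i + 1) * catalan (m - i) + catalan i * onceNum true (2 * (m - i)) +
        catalan i * if m - i = 0 then 0 else catalan (m - i)) := by
  rw [show 2 * (m + 1) = 2 * m + 1 + 1 by ring, onceNum_succ,
    show 2 * m + 1 + 1 = 2 * (m + 1) by ring, sum_range_bodd]
  refine Finset.sum_congr rfl fun i hi => ?_
  rw [Finset.mem_range] at hi
  have h : 2 * m + 1 - (2 * i + true.toNat) = 2 * (m - i) := by simp; omega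
  have h₁ : (2 * i + 1) / 2 = i := by omega
  rw [h]
  simp [onceTerm, avoidNum, h₁]

theorem onceNum_false_even (m : ℕ) :
    onceNum false (2 * (m + 1)) = ∑ i ∈ Finset.range (m + 1),
      (onceNum false (2 * i) * catalan (m - i) + catalan i * onceNum true (2 * (m - i) + 1) +
        (if i = 0 then 0 else catalan i) * catalan (m - i)) := by
  rw [show 2 * (m + 1) = 2 * m + 1 + 1 by ring, onceNum_succ,
    show 2 * m + 1 + 1 = 2 * (m + 1) by ring, sum_range_bodd]
  refine Finset.sum_congr rfl fun i hi => ?_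
  rw [Finset.mem_range] at hi
  have h : 2 * m + 1 - (2 * i + false.toNat) = 2 * (m - i) + 1 := by simp; omega
  have h₁ : (2 * i + 1) / 2 = i := by omega
  have h₂ : (2 * (m - i) + 1) / 2 = m - i := by omega
  have h₃ : i ≠ 0 → 2 * i - 1 + 1 = 2 * i := by omega
  rw [h]
  by_cases hi : i = 0 <;> simp [onceTerm, avoidNum, h₁, h₂, h₃, hi, onceNum_eq_zero]

theorem onceNum_false_odd (m : ℕ) :
    onceNum false (2 * m + 1) = ∑ i ∈ Finset.range (m + 1),
      (onceNum false (2 * i) * catalan (m - i) + catalan i * onceNum true (2 * (m - i)) +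
        (if i = 0 then 0 else catalan i) * if m - i = 0 then 0 else catalan (m - i)) := by
  have key : ∀ i, i ≤ m → onceTerm false (2 * i) (2 * m - 2 * i) =
      onceNum false (2 * i) * catalan (m - i) + catalan i * onceNum true (2 * (m - i)) +
        (if i = 0 then 0 else catalan i) * if m - i = 0 then 0 else catalan (m - i) := by
    intro i hi
    have h₁ : (2 * i + 1) / 2 = i := by omega
    have h₃ : i ≠ 0 → 2 * i - 1 + 1 = 2 * i := by omega
    rw [← Nat.mul_sub]
    by_cases hi : i = 0 <;> simp [onceTerm, avoidNum, h₁, h₃, hi]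
  rw [onceNum_succ, Finset.sum_range_succ, Finset.sum_range_succ, sum_range_bodd, ← key m le_rfl]
  congr 1
  · exact Finset.sum_congr rfl fun i hi => key i (Finset.mem_range.mp hi).le
  · simp

theorem onceSeries_true_one_rec : onceSeries true 1 =
    X * (onceSeries true 1 * catSeries + catSeries * onceSeries true 1 +
      catSeries * catSeries) := by
  ext m
  cases m with
  | zero => simp [coeff_onceSeries, onceNum_eq_zero]
  | succ m =>
    rw [coeff_succ_X_mul, coeff_onceSeries, onceNum_true_odd, map_add, map_add]
    simp only [coeff_mul_range, coeff_onceSeries, coeff_catSeries, ← Finset.sum_add_distrib]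
    push_cast
    rfl

theorem onceSeries_true_zero_rec : onceSeries true 0 =
    X * (onceSeries true 1 * catSeries + catSeries * onceSeries true 0 +
      catSeries * (catSeries - 1)) := by
  ext m
  cases m with
  | zero => simp [coeff_onceSeries, onceNum_eq_zero]
  | succ m =>
    rw [coeff_succ_X_mul, coeff_onceSeries, add_zero, onceNum_true_even, map_add, map_add]
    simp only [coeff_mul_range, coeff_onceSeries, coeff_catSeries, coeff_catSeries_sub_one,
      ← Finset.sum_add_distrib, add_zero]
    push_cast
    rfl

theorem onceSeries_false_zero_rec : onceSeries false 0 =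
    X * (onceSeries false 0 * catSeries + catSeries * onceSeries true 1 +
      (catSeries - 1) * catSeries) := by
  ext m
  cases m with
  | zero => simp [coeff_onceSeries, onceNum_eq_zero]
  | succ m =>
    rw [coeff_succ_X_mul, coeff_onceSeries, add_zero, onceNum_false_even, map_add, map_add]
    simp only [coeff_mul_range, coeff_onceSeries, coeff_catSeries, coeff_catSeries_sub_one,
      ← Finset.sum_add_distrib, add_zero]
    push_cast
    rfl

theorem onceSeries_false_one_rec : onceSeries false 1 =
    onceSeries false 0 * catSeries + catSeries * onceSeries true 0 +
      (catSeries - 1) * (catSeries - 1) := by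
  ext m
  rw [coeff_onceSeries, onceNum_false_odd, map_add, map_add]
  simp only [coeff_mul_range, coeff_onceSeries, coeff_catSeries, coeff_catSeries_sub_one,
    ← Finset.sum_add_distrib, add_zero]
  push_cast
  rfl

theorem catSeries_mul : catSeries * (1 - X * catSeries) = 1 := by
  linear_combination catSeries_eq

theorem X_eq : (X : ℚ⟦X⟧) = X * catSeries - (X * catSeries) ^ 2 := by
  linear_combination -X * catSeries_eq

theorem onceSeries_true_one_eq : onceSeries true 1 = centralSeries * (catSeries - 1) := by
  linear_combination centralSeries * onceSeries_true_one_rec -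
    onceSeries true 1 * centralSeries_mul - centralSeries * catSeries_eq

theorem onceSeries_true_one : 2 * X * onceSeries true 1 = (1 - 2 * X) * centralSeries - 1 := by
  linear_combination 2 * X * onceSeries_true_one_eq - centralSeries_mul

/-- With `G = y C(y)`, the series `y E(y)` of the words of even length that begin with
a rise is `2G³ / (1 - 2G)`. -/
theorem X_mul_onceSeries_true_zero :
    X * onceSeries true 0 = 2 * (X * catSeries) ^ 3 * centralSeries := by
  have h₁ : onceSeries true 0 =
      X * catSeries * (onceSeries true 1 * catSeries + catSeries * (catSeries - 1)) := by
    linear_combination catSeries * onceSeries_true_zero_rec -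
      onceSeries true 0 * catSeries_mul
  have h₂ : X * onceSeries true 0 =
      (X * catSeries) ^ 2 * ((centralSeries + 1) * (catSeries - 1)) := by
    linear_combination X * h₁ + (X * catSeries) ^ 2 * onceSeries_true_one_eq
  have h₃ : (centralSeries + 1) * (catSeries - 1) = 2 * (X * catSeries) * centralSeries := by
    have h₄ : catSeries - 1 = X * catSeries * catSeries := by
      linear_combination catSeries_eq
    linear_combination (centralSeries + 1) * h₄ - X * catSeries * catSeries * centralSeries_mul +
      2 * (X * catSeries) * centralSeries * catSeries_mul
  rw [h₂, h₃]
  ring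

theorem onceSeries_true_zero :
    X * onceSeries true 0 = X - 1 + (1 - 3 * X) * centralSeries := by
  have key : ∀ y G B : ℚ⟦X⟧, y = G - G ^ 2 → B * (1 - 2 * G) = 1 →
      2 * G ^ 3 * B = y - 1 + (1 - 3 * y) * B := by
    rintro y G B rfl hB
    linear_combination (G - G ^ 2 - 1) * hB
  rw [X_mul_onceSeries_true_zero]
  exact key X (X * catSeries) centralSeries X_eq (by linear_combination centralSeries_mul)

theorem onceSeries_false_zero : onceSeries false 0 = onceSeries true 0 := by
  linear_combination catSeries * onceSeries_false_zero_rec -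
      onceSeries false 0 * catSeries_mul - catSeries * onceSeries_true_zero_rec +
      onceSeries true 0 * catSeries_mul

theorem onceSeries_false_one :
    2 * X ^ 2 * onceSeries false 1 = 2 * X ^ 2 + 4 * X - 3 + (3 - 10 * X) * centralSeries := by
  have key : ∀ y G B : ℚ⟦X⟧, y = G - G ^ 2 → B * (1 - 2 * G) = 1 →
      8 * G ^ 4 * B + 2 * (G - y) ^ 2 = 2 * y ^ 2 + 4 * y - 3 + (3 - 10 * y) * B := by
    rintro y G B rfl hB
    linear_combination -(2 * G ^ 4 - 2 * (G - G ^ 2) ^ 2 - 4 * (G - G ^ 2) + 3) * hB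
  rw [← key X (X * catSeries) centralSeries X_eq (by linear_combination centralSeries_mul)]
  linear_combination 2 * X ^ 2 * onceSeries_false_one_rec +
    2 * X ^ 2 * catSeries * onceSeries_false_zero +
    4 * X * catSeries * X_mul_onceSeries_true_zero

/-! ### From permutations to words -/

/-- The one-line notation of a permutation. -/
def word {n : ℕ} (π : Equiv.Perm (Fin n)) : List ℕ :=
  List.ofFn fun i => (π i : ℕ)

theorem triple_sublist_ofFn {n : ℕ} {f : Fin n → ℕ} {a b c : ℕ} :
    [a, b, c].Sublist (List.ofFn f) ↔
      ∃ i j k, i < j ∧ j < k ∧ f i = a ∧ f j = b ∧ f k = c := by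
  rw [List.sublist_iff_exists_fin_orderEmbedding_get_eq]
  constructor
  · rintro ⟨g, hg⟩
    have h : ∀ i, (g i : ℕ) < n := fun i => (g i).2.trans_eq (List.length_ofFn)
    have h₀ := hg ⟨0, by simp⟩
    have h₁ := hg ⟨1, by simp⟩
    have h₂ := hg ⟨2, by simp⟩
    simp at h₀ h₁ h₂
    refine ⟨⟨g ⟨0, by simp⟩, h _⟩, ⟨g ⟨1, by simp⟩, h _⟩, ⟨g ⟨2, by simp⟩, h _⟩, ?_, ?_,
      h₀.symm, h₁.symm, h₂.symm⟩
    · exact g.strictMono (by simp)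
    · exact g.strictMono (by simp)
  · rintro ⟨i, j, k, hij, hjk, rfl, rfl, rfl⟩
    have hlen : n = (List.ofFn f).length := (List.length_ofFn).symm
    refine ⟨OrderEmbedding.ofStrictMono (fun t : Fin 3 => Fin.cast hlen (![i, j, k] t)) ?_, ?_⟩
    · rw [Fin.strictMono_iff_lt_succ]
      intro t
      fin_cases t
      · exact hij
      · exact hjk
    · intro t
      change Fin 3 at t
      fin_cases t <;> simp

theorem occurs_word {n : ℕ} {π : Equiv.Perm (Fin n)} {a b c : ℕ} :
    Occurs (word π) a b c ↔ ∃ i j k, i < j ∧ j < k ∧ π i < π k ∧ π k < π j ∧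
      (π i : ℕ) = a ∧ (π j : ℕ) = b ∧ (π k : ℕ) = c := by
  rw [Occurs, word, triple_sublist_ofFn]
  constructor
  · rintro ⟨⟨i, j, k, hij, hjk, rfl, rfl, rfl⟩, h, h'⟩
    exact ⟨i, j, k, hij, hjk, h, h', rfl, rfl, rfl⟩
  · rintro ⟨i, j, k, hij, hjk, h, h', rfl, rfl, rfl⟩
    exact ⟨⟨i, j, k, hij, hjk, rfl, rfl, rfl⟩, h, h'⟩

theorem occ132_eq_one_iff {n : ℕ} (π : Equiv.Perm (Fin n)) :
    occ132 π = 1 ↔ ContainsOnce (word π) := by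
  rw [occ132, Finset.card_eq_one]
  have inj : ∀ i j, (π i : ℕ) = π j → i = j := fun i j h => π.injective (Fin.ext h)
  constructor
  · rintro ⟨⟨i, j, k⟩, h⟩
    simp only [Finset.ext_iff, Finset.mem_filter, Finset.mem_univ, true_and,
      Finset.mem_singleton, Prod.forall, Prod.mk.injEq] at h
    obtain ⟨h₁, h₂, h₃, h₄⟩ := (h i j k).mpr ⟨rfl, rfl, rfl⟩
    refine ⟨π i, π j, π k, occurs_word.mpr ⟨i, j, k, h₁, h₂, h₃, h₄, rfl, rfl, rfl⟩,
      fun a b c ho => ?_⟩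
    obtain ⟨i', j', k', h₁, h₂, h₃, h₄, rfl, rfl, rfl⟩ := occurs_word.mp ho
    obtain ⟨rfl, rfl, rfl⟩ := (h i' j' k').mp ⟨h₁, h₂, h₃, h₄⟩
    exact ⟨rfl, rfl, rfl⟩
  · rintro ⟨a, b, c, ho, hu⟩
    obtain ⟨i, j, k, h₁, h₂, h₃, h₄, rfl, rfl, rfl⟩ := occurs_word.mp ho
    refine ⟨(i, j, k), ?_⟩
    ext ⟨i', j', k'⟩
    simp only [Finset.mem_filter, Finset.mem_univ, true_and, Finset.mem_singleton, Prod.mk.injEq]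
    constructor
    · rintro ⟨h₁, h₂, h₃, h₄⟩
      obtain ⟨e₁, e₂, e₃⟩ := hu _ _ _ (occurs_word.mpr
        ⟨i', j', k', h₁, h₂, h₃, h₄, rfl, rfl, rfl⟩)
      exact ⟨inj _ _ e₁, inj _ _ e₂, inj _ _ e₃⟩
    · rintro ⟨rfl, rfl, rfl⟩
      exact ⟨h₁, h₂, h₃, h₄⟩

theorem word_mem_words {n : ℕ} (π : Equiv.Perm (Fin n)) : word π ∈ words (Finset.range n) := by
  rw [mem_words, word, List.nodup_ofFn]
  refine ⟨fun i j h => π.injective (Fin.ext h), fun x => ?_⟩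
  rw [List.mem_ofFn, Finset.mem_range]
  constructor
  · rintro ⟨i, rfl⟩
    exact (π i).2
  · intro hx
    exact ⟨π.symm ⟨x, hx⟩, by simp⟩

theorem word_injective {n : ℕ} : Function.Injective (word (n := n)) := by
  intro π π' h
  have h' := List.ofFn_injective h
  ext i
  exact congrFun h' i

theorem exists_word_eq {n : ℕ} {l : List ℕ} (hl : l ∈ words (Finset.range n)) :
    ∃ π : Equiv.Perm (Fin n), word π = l := by
  have hlen : l.length = n := by rw [length_of_mem_words hl, Finset.card_range]
  obtain ⟨hnd, hmem⟩ := mem_words.mp hl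
  subst hlen
  let f : Fin l.length → Fin l.length := fun i =>
    ⟨l.get i, Finset.mem_range.mp ((hmem _).mp (l.get_mem i))⟩
  have hf : Function.Injective f := fun i j h =>
    List.nodup_iff_injective_get.mp hnd (congrArg Fin.val h)
  exact ⟨Equiv.ofBijective f (Finite.injective_iff_bijective.mp hf), List.ofFn_get l⟩

theorem countOnce_eq_onceNum {n : ℕ} {P : Equiv.Perm (Fin n) → Prop} {s : Bool}
    (h : ∀ π, occ132 π = 1 → (P π ↔ Alternates s (word π))) : countOnce n P = onceNum s n := by
  rw [countOnce, onceNum, ← Fintype.card_coe, ← Nat.card_eq_fintype_card]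
  have hmem : ∀ π, P π ∧ occ132 π = 1 ↔ word π ∈ onceSet s (Finset.range n) := by
    intro π
    rw [mem_onceSet, ← occ132_eq_one_iff]
    have := word_mem_words π
    have := h π
    tauto
  refine Nat.card_eq_of_bijective (fun π => ⟨word π.1, (hmem π.1).mp π.2⟩) ⟨?_, ?_⟩
  · intro π π' he
    exact Subtype.ext (word_injective (congrArg Subtype.val he))
  · rintro ⟨l, hl⟩
    obtain ⟨π, rfl⟩ := exists_word_eq (mem_onceSet.mp hl).1
    exact ⟨⟨π, (hmem π).mpr hl⟩, rfl⟩

theorem countOnce_eq_zero {n : ℕ} {P : Equiv.Perm (Fin n) → Prop} (h : ∀ π, ¬ P π) :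
    countOnce n P = 0 := by
  rw [countOnce, Nat.card_eq_zero]
  exact Or.inl ⟨fun π => h π.1 π.2.1⟩

/-! ### The types of alternating permutations -/

theorem alternates_iff_getElem {s : Bool} {l : List ℕ} :
    Alternates s l ↔ ∀ (i : ℕ) (h : i + 1 < l.length),
      if i.bodd = s then l[i + 1] < l[i] else l[i] < l[i + 1] := by
  induction l generalizing s with
  | nil => simp [Alternates]
  | cons a l ih =>
    cases l with
    | nil => simp [Alternates]
    | cons b l =>
      rw [Alternates, ih]
      constructor
      · rintro ⟨h₀, h⟩ i hi
        cases i with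
        | zero => cases s <;> simpa using h₀
        | succ i =>
          have := h i (by simpa using hi)
          cases s <;> simpa using this
      · intro h
        constructor
        · have := h 0 (by simp)
          cases s <;> simpa using this
        · intro i hi
          have := h (i + 1) (by simpa using hi)
          cases s <;> simpa using this

theorem alternates_word_iff {n : ℕ} {π : Equiv.Perm (Fin n)} {s : Bool} :
    Alternates s (word π) ↔
      ∀ i, i + 1 < n → if i.bodd = s then DescentAt π i else RiseAt π i := by
  rw [alternates_iff_getElem]
  refine forall_congr' fun i => ?_
  simp only [word, List.length_ofFn, List.getElem_ofFn, Fin.val_fin_lt]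
  refine forall_congr' fun hi => ?_
  simp [DescentAt, RiseAt, hi]

theorem riseAt_iff_not_descentAt {n : ℕ} {π : Equiv.Perm (Fin n)} {i : ℕ} (hi : i + 1 < n) :
    RiseAt π i ↔ ¬ DescentAt π i := by
  have hne : π ⟨i, Nat.lt_of_succ_lt hi⟩ ≠ π ⟨i + 1, hi⟩ := fun h => by
    simpa using π.injective h
  simp only [RiseAt, DescentAt, hi, exists_true_left, not_lt]
  exact ⟨le_of_lt, fun h => h.lt_of_ne hne⟩

theorem alternates_word_iff_inTurn {n : ℕ} (hn : 2 ≤ n) {π : Equiv.Perm (Fin n)} {s : Bool} :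
    Alternates s (word π) ↔ (RiseAt π 0 ↔ s = true) ∧ InTurn π := by
  have hrise : Alternates s (word π) ↔ ∀ i, i + 1 < n → (RiseAt π i ↔ i.bodd = !s) := by
    rw [alternates_word_iff]
    refine forall_congr' fun i => forall_congr' fun hi => ?_
    have := riseAt_iff_not_descentAt (π := π) hi
    by_cases h : i.bodd = s
    · simp [h, this]
    · have h' : i.bodd = !s := by revert h; cases i.bodd <;> cases s <;> simp
      simp [h']
  rw [hrise]
  constructor
  · intro h
    refine ⟨by rw [h 0 hn]; cases s <;> simp, fun i hi => ?_⟩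
    have h₁ := h i (by omega)
    have h₂ := h (i + 1) hi
    rw [riseAt_iff_not_descentAt hi, Nat.bodd_succ] at h₂
    rw [h₁, ← not_iff_not, h₂]
    cases i.bodd <;> cases s <;> simp
  · rintro ⟨h₀, h⟩ i
    induction i with
    | zero => intro _; rw [h₀]; cases s <;> simp
    | succ i ih =>
      intro hi
      rw [riseAt_iff_not_descentAt hi, ← h i hi, ih (by omega), Nat.bodd_succ]
      cases i.bodd <;> cases s <;> simp

theorem three_le_of_occ132_eq_one {n : ℕ} {π : Equiv.Perm (Fin n)} (h : occ132 π = 1) : 3 ≤ n := by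
  obtain ⟨a, b, c, ⟨ho, -⟩, -⟩ := (occ132_eq_one_iff π).mp h
  simpa [word] using ho.length_le

theorem riseAt_of_alternates {n : ℕ} {π : Equiv.Perm (Fin n)} {s : Bool}
    (h : Alternates s (word π)) (hn : 2 ≤ n) : RiseAt π (n - 2) ↔ n.bodd = !s := by
  obtain ⟨k, rfl⟩ : ∃ k, n = k + 2 := ⟨n - 2, by omega⟩
  have h₁ := alternates_word_iff.mp h k (by omega)
  have h₂ := riseAt_iff_not_descentAt (π := π) (i := k) (by omega)
  simp only [Nat.add_sub_cancel, Nat.bodd_succ, Bool.not_not]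
  split_ifs at h₁ with hk
  · rw [hk, h₂]
    simp [h₁]
  · simp only [h₁, true_iff]
    revert hk; cases k.bodd <;> cases s <;> simp

/-- All four types are given by the first step and the parity of the length. -/
theorem countOnce_eq_ite {n : ℕ} {P : Equiv.Perm (Fin n) → Prop} (s e : Bool)
    (h : ∀ π, P π ↔ 2 ≤ n ∧ (RiseAt π 0 ↔ s = true) ∧ InTurn π ∧
      (RiseAt π (n - 2) ↔ e = true)) :
    countOnce n P = if n.bodd = (s == e).not then onceNum s n else 0 := by
  split_ifs with hn
  · refine countOnce_eq_onceNum fun π hπ => ?_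
    have h2 : 2 ≤ n := by have := three_le_of_occ132_eq_one hπ; omega
    rw [h, alternates_word_iff_inTurn h2]
    refine ⟨fun h' => ⟨h'.2.1, h'.2.2.1⟩, fun h' => ⟨h2, h'.1, h'.2, ?_⟩⟩
    rw [riseAt_of_alternates ((alternates_word_iff_inTurn h2).mpr h') h2, hn]
    cases s <;> cases e <;> simp
  · refine countOnce_eq_zero fun π hπ => hn ?_
    obtain ⟨h2, h₁, h₃, h₄⟩ := (h π).mp hπ
    rw [riseAt_of_alternates ((alternates_word_iff_inTurn h2).mpr ⟨h₁, h₃⟩) h2] at h₄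
    revert h₄
    cases n.bodd <;> cases s <;> cases e <;> simp

theorem countOnce_isUpDown (n : ℕ) :
    countOnce n IsUpDown = if n.bodd = true then onceNum true n else 0 := by
  refine countOnce_eq_ite true false fun π => and_congr_right fun hn => ?_
  have h₁ := riseAt_iff_not_descentAt (π := π) (i := n - 2) (by omega)
  simp only [iff_true, Bool.false_eq_true, iff_false]
  tauto

theorem countOnce_isUpUp (n : ℕ) :
    countOnce n IsUpUp = if n.bodd = false then onceNum true n else 0 := by
  refine countOnce_eq_ite true true fun π => and_congr_right fun hn => ?_
  simp only [iff_true]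

theorem countOnce_isDownDown (n : ℕ) :
    countOnce n IsDownDown = if n.bodd = false then onceNum false n else 0 := by
  refine countOnce_eq_ite false false fun π => and_congr_right fun hn => ?_
  have h₁ := riseAt_iff_not_descentAt (π := π) (i := n - 2) (by omega)
  have h₂ := riseAt_iff_not_descentAt (π := π) (i := 0) (by omega)
  simp only [Bool.false_eq_true, iff_false]
  tauto

theorem countOnce_isDownUp (n : ℕ) :
    countOnce n IsDownUp = if n.bodd = true then onceNum false n else 0 := by
  refine countOnce_eq_ite false true fun π => and_congr_right fun hn => ?_
  have h₂ := riseAt_iff_not_descentAt (π := π) (i := 0) (by omega)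
  simp only [Bool.false_eq_true, iff_false, iff_true]
  tauto

theorem countOnce_isAlternating (n : ℕ) : countOnce n IsAlternating = onceNum true n := by
  refine countOnce_eq_onceNum fun π _ => ?_
  rw [alternates_word_iff]
  refine forall_congr' fun i => forall_congr' fun _ => ?_
  obtain ⟨k, rfl | rfl⟩ := i.even_or_odd' <;> simp

/-! ### Closed forms -/

theorem binom_natCast (a b : ℕ) : binom a b = (a.choose b : ℚ) := by
  by_cases h : b ≤ a
  · simp [binom, h]
  · simp [binom, h, Nat.choose_eq_zero_of_lt (not_le.mp h)]

theorem binom_of_neg (a : ℤ) {b : ℚ} (hb : b < 0) : binom a b = 0 := by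
  simp [binom, hb.not_ge]

theorem binom_half_odd (a k : ℤ) : binom a ((2 * k + 1 : ℤ) / 2) = 0 := by
  rw [binom, if_neg]
  rintro ⟨h, -⟩
  have h₁ := (Rat.den_eq_one_iff _).mp h
  have h₂ : (2 * k + 1 : ℤ) = 2 * (((2 * k + 1 : ℤ) : ℚ) / 2).num := by
    have : ((2 * k + 1 : ℤ) : ℚ) = 2 * ((((2 * k + 1 : ℤ) : ℚ) / 2).num : ℚ) := by
      rw [h₁]; ring
    exact_mod_cast this
  omega

theorem onceNum_true_odd_eq (m : ℕ) :
    2 * (onceNum true (2 * m + 1) : ℚ) = (m + 1).centralBinom - 2 * m.centralBinom := by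
  have h := congrArg (PowerSeries.coeff (m + 1)) onceSeries_true_one
  rw [show 2 * PowerSeries.X * onceSeries true 1 = PowerSeries.X * (2 * onceSeries true 1) by ring,
    show (1 - 2 * PowerSeries.X) * centralSeries =
      centralSeries - PowerSeries.X * (2 * centralSeries) by ring] at h
  simp only [two_mul, map_sub, PowerSeries.coeff_succ_X_mul, map_add, coeff_onceSeries,
    PowerSeries.coeff_one, centralSeries, PowerSeries.coeff_mk] at h
  simp only [two_mul]
  simpa using h

theorem onceNum_true_even_eq (m : ℕ) :
    (onceNum true (2 * m) : ℚ) =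
      (m + 1).centralBinom - 3 * m.centralBinom + if m = 0 then 1 else 0 := by
  have h := congrArg (PowerSeries.coeff (m + 1)) onceSeries_true_zero
  rw [show PowerSeries.X - 1 + (1 - 3 * PowerSeries.X) * centralSeries =
      PowerSeries.X * (1 - (centralSeries + centralSeries + centralSeries)) +
        centralSeries - 1 by ring] at h
  simp only [map_sub, PowerSeries.coeff_succ_X_mul, map_add, coeff_onceSeries,
    PowerSeries.coeff_one, centralSeries, PowerSeries.coeff_mk, add_zero, Nat.add_eq_zero_iff,
    one_ne_zero, and_false, if_false] at h
  rw [h]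
  ring

theorem onceNum_false_even_eq (m : ℕ) : onceNum false (2 * m) = onceNum true (2 * m) := by
  have h := congrArg (PowerSeries.coeff m) onceSeries_false_zero
  rw [coeff_onceSeries, coeff_onceSeries] at h
  exact_mod_cast h

/-- The length `1` is excluded, as the polynomial part of the generating function contributes to its
coefficient. -/
theorem onceNum_false_odd_eq {m : ℕ} (hm : m ≠ 0) :
    2 * (onceNum false (2 * m + 1) : ℚ) =
      3 * (m + 2).centralBinom - 10 * (m + 1).centralBinom := by
  have h := congrArg (PowerSeries.coeff (m + 2)) onceSeries_false_one
  have c₂ : (PowerSeries.C 2 : PowerSeries ℚ) = 2 := map_ofNat _ 2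
  have c₃ : (PowerSeries.C 3 : PowerSeries ℚ) = 3 := map_ofNat _ 3
  have c₄ : (PowerSeries.C 4 : PowerSeries ℚ) = 4 := map_ofNat _ 4
  have c₁₀ : (PowerSeries.C 10 : PowerSeries ℚ) = 10 := map_ofNat _ 10
  have e₁ : 2 * PowerSeries.X ^ 2 * onceSeries false 1 =
      PowerSeries.X ^ 2 * (PowerSeries.C (2 : ℚ) * onceSeries false 1) := by
    rw [c₂]; ring
  have e₂ : 2 * PowerSeries.X ^ 2 + 4 * PowerSeries.X - 3 +
      (3 - 10 * PowerSeries.X) * centralSeries =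
      PowerSeries.X ^ 2 * PowerSeries.C 2 + PowerSeries.X * (PowerSeries.C 4 -
        PowerSeries.C 10 * centralSeries) + PowerSeries.C 3 * centralSeries - PowerSeries.C 3 := by
    rw [c₂, c₃, c₄, c₁₀]; ring
  rw [e₁, e₂, show m + 2 = 2 + m by ring, PowerSeries.coeff_X_pow_mul' , if_pos (by omega)] at h
  simp only [map_sub, map_add, PowerSeries.coeff_X_pow_mul', PowerSeries.coeff_C_mul,
    PowerSeries.coeff_C, coeff_onceSeries, centralSeries, PowerSeries.coeff_mk,
    show 2 + m = (m + 1) + 1 by ring, PowerSeries.coeff_succ_X_mul] at h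
  simp [hm, show m + 1 + 1 - 2 = m by omega] at h
  rw [h]
  ring

theorem centralBinom_succ (m : ℕ) : (m + 1).centralBinom = 2 * (2 * m + 1).choose m := by
  rw [Nat.centralBinom, show 2 * (m + 1) = 2 * m + 1 + 1 by ring, Nat.choose_succ_succ',
    Nat.choose_symm_half]
  ring

theorem onceNum_true_odd_eq_binom (m : ℕ) :
    (onceNum true (2 * m + 1) : ℚ) =
      binom ((2 * m + 1 : ℕ) - 1) ((((2 * m + 1 : ℕ) : ℚ) - 3) / 2) := by
  have h := onceNum_true_odd_eq m
  rw [centralBinom_succ] at h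
  cases m with
  | zero =>
    rw [binom_of_neg _ (by norm_num)]
    simpa using h
  | succ k =>
    rw [show (((2 * (k + 1) + 1 : ℕ) : ℤ) - 1) = ((2 * (k + 1) : ℕ) : ℤ) by push_cast; ring,
      show ((((2 * (k + 1) + 1 : ℕ) : ℚ) - 3) / 2) = (k : ℕ) by push_cast; ring, binom_natCast]
    rw [Nat.choose_succ_succ', ← Nat.centralBinom] at h
    push_cast at h ⊢
    linarith

theorem onceNum_true_even_eq_binom (m : ℕ) :
    (onceNum true (2 * m) : ℚ) = 2 * binom ((2 * m : ℕ) - 1) ((((2 * m : ℕ) : ℚ) - 4) / 2) := by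
  match m with
  | 0 => rw [binom_of_neg _ (by norm_num), onceNum_eq_zero (by norm_num)]; simp
  | 1 => rw [binom_of_neg _ (by norm_num), onceNum_eq_zero (by norm_num)]; simp
  | k + 2 =>
    have h := onceNum_true_even_eq (k + 2)
    rw [show (((2 * (k + 2) : ℕ) : ℤ) - 1) = ((2 * k + 3 : ℕ) : ℤ) by push_cast; ring,
      show ((((2 * (k + 2) : ℕ) : ℚ) - 4) / 2) = (k : ℕ) by push_cast; ring, binom_natCast, h]
    have h₁ : (2 * (k + 2) + 1).choose (k + 2) =
        (2 * (k + 2)).choose (k + 1) + (k + 2).centralBinom := Nat.choose_succ_succ' _ _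
    have h₂ : (2 * (k + 2)).choose (k + 1) = (2 * k + 3).choose k + (2 * k + 3).choose (k + 1) :=
      Nat.choose_succ_succ' _ _
    have h₃ : (k + 2).centralBinom = 2 * (2 * k + 3).choose (k + 1) := centralBinom_succ (k + 1)
    rw [centralBinom_succ, h₁, h₂, h₃]
    push_cast
    simp
    ring

theorem binom_sub_three_even (a : ℤ) (m : ℕ) : binom a ((((2 * m : ℕ) : ℚ) - 3) / 2) = 0 := by
  convert binom_half_odd a (m - 2) using 3
  push_cast; ring

theorem binom_sub_four_odd (a : ℤ) (m : ℕ) : binom a ((((2 * m + 1 : ℕ) : ℚ) - 4) / 2) = 0 := by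
  convert binom_half_odd a (m - 2) using 3
  push_cast; ring

theorem countOnce_isUpDown_eq_binom (n : ℕ) :
    (countOnce n IsUpDown : ℚ) = binom ((n : ℤ) - 1) (((n : ℚ) - 3) / 2) := by
  rw [countOnce_isUpDown]
  obtain ⟨m, rfl | rfl⟩ := n.even_or_odd'
  · rw [binom_sub_three_even]; simp
  · rw [← onceNum_true_odd_eq_binom]; simp

theorem countOnce_isUpUp_eq_binom (n : ℕ) :
    (countOnce n IsUpUp : ℚ) = 2 * binom ((n : ℤ) - 1) (((n : ℚ) - 4) / 2) := by
  rw [countOnce_isUpUp]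
  obtain ⟨m, rfl | rfl⟩ := n.even_or_odd'
  · rw [← onceNum_true_even_eq_binom]; simp
  · rw [binom_sub_four_odd]; simp

theorem countOnce_isDownDown_eq (n : ℕ) : countOnce n IsDownDown = countOnce n IsUpUp := by
  rw [countOnce_isUpUp, countOnce_isDownDown]
  obtain ⟨m, rfl | rfl⟩ := n.even_or_odd'
  · rw [onceNum_false_even_eq]
  · simp

theorem countOnce_isDownUp_eq_binom {n : ℕ} (hn : n ≠ 1) :
    (countOnce n IsDownUp : ℚ) = 3 / 2 * binom ((n : ℤ) + 3) (((n : ℚ) + 3) / 2) -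
      5 * binom ((n : ℤ) + 1) (((n : ℚ) + 1) / 2) := by
  rw [countOnce_isDownUp]
  obtain ⟨m, rfl | rfl⟩ := n.even_or_odd'
  · have h₁ : binom (((2 * m : ℕ) : ℤ) + 3) ((((2 * m : ℕ) : ℚ) + 3) / 2) = 0 := by
      convert binom_half_odd _ (m + 1) using 3
      push_cast; ring
    have h₂ : binom (((2 * m : ℕ) : ℤ) + 1) ((((2 * m : ℕ) : ℚ) + 1) / 2) = 0 := by
      convert binom_half_odd _ m using 3
      push_cast; ring
    rw [h₁, h₂]
    simp
  · have h := onceNum_false_odd_eq (m := m) (by omega)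
    rw [show ((2 * m + 1 : ℕ) : ℤ) + 3 = ((2 * (m + 2) : ℕ) : ℤ) by push_cast; ring,
      show (((2 * m + 1 : ℕ) : ℚ) + 3) / 2 = ((m + 2 : ℕ) : ℚ) by push_cast; ring,
      show ((2 * m + 1 : ℕ) : ℤ) + 1 = ((2 * (m + 1) : ℕ) : ℤ) by push_cast; ring,
      show (((2 * m + 1 : ℕ) : ℚ) + 1) / 2 = ((m + 1 : ℕ) : ℚ) by push_cast; ring,
      binom_natCast, binom_natCast, ← Nat.centralBinom, ← Nat.centralBinom]
    simp
    linarith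

theorem countOnce_isAlternating_eq_binom (n : ℕ) :
    (countOnce n IsAlternating : ℚ) = binom ((n : ℤ) - 1) (((n : ℚ) - 3) / 2) +
      2 * binom ((n : ℤ) - 1) (((n : ℚ) - 4) / 2) := by
  rw [← countOnce_isUpDown_eq_binom, ← countOnce_isUpUp_eq_binom, countOnce_isAlternating,
    countOnce_isUpDown, countOnce_isUpUp]
  cases n.bodd <;> simp

/-! ### The identities between Laurent series -/

/-- The substitution `y = x²`, from power series in `y` to Laurent series in `x`. -/
noncomputable def toLaurent : PowerSeries ℚ →+* LaurentSeries ℚ :=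
  (HahnSeries.ofPowerSeries ℤ ℚ).comp (PowerSeries.expand 2 two_ne_zero).toRingHom

theorem toLaurent_apply (f : PowerSeries ℚ) :
    toLaurent f = HahnSeries.ofPowerSeries ℤ ℚ (PowerSeries.expand 2 two_ne_zero f) :=
  rfl

theorem toLaurent_X : toLaurent PowerSeries.X = x ^ 2 := by
  rw [toLaurent_apply, PowerSeries.expand_X, map_pow, x]

theorem root_eq : root = 1 - 2 * x ^ 2 * toLaurent catSeries := by
  rw [root, rootPS, toLaurent_apply, catSeries, x, map_sub, map_mul, map_mul, map_pow, map_one,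
    map_ofNat]

theorem root_sq : root ^ 2 = 1 - 4 * x ^ 2 := by
  rw [root, ← map_pow, rootPS_sq, x, map_sub, map_mul, map_pow, map_one, map_ofNat]

theorem x_ne_zero : x ≠ 0 := by
  rw [x, map_ne_zero_iff _ HahnSeries.ofPowerSeries_injective]
  exact PowerSeries.X_ne_zero

theorem two_ne_zero_laurentSeries : (2 : LaurentSeries ℚ) ≠ 0 := by
  rw [← map_ofNat (HahnSeries.ofPowerSeries ℤ ℚ) 2,
    map_ne_zero_iff _ HahnSeries.ofPowerSeries_injective]
  intro h
  have := congrArg PowerSeries.constantCoeff h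
  rw [map_ofNat, map_zero] at this
  norm_num at this

theorem root_add_one_ne_zero : root + 1 ≠ 0 := by
  rw [root, ← map_one (HahnSeries.ofPowerSeries ℤ ℚ), ← map_add,
    map_ne_zero_iff _ HahnSeries.ofPowerSeries_injective]
  intro h
  have := congrArg PowerSeries.constantCoeff h
  rw [map_add, rootPS_constantCoeff, map_one, map_zero] at this
  norm_num at this

theorem toLaurent_centralSeries_mul_root : toLaurent centralSeries * root = 1 := by
  have h := congrArg toLaurent centralSeries_mul
  simp only [map_mul, map_sub, map_one, map_ofNat, toLaurent_X] at h
  rw [root_eq, h]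

theorem root_ne_zero : root ≠ 0 :=
  right_ne_zero_of_mul_eq_one toLaurent_centralSeries_mul_root

theorem toLaurent_centralSeries : toLaurent centralSeries = 1 / root :=
  eq_div_of_mul_eq root_ne_zero toLaurent_centralSeries_mul_root

theorem genFun_even (s : Bool) :
    genFun (fun n => if n.bodd = false then onceNum s n else 0) = toLaurent (onceSeries s 0) := by
  rw [genFun, toLaurent_apply]
  congr 1
  ext n
  rw [PowerSeries.coeff_mk]
  obtain ⟨m, rfl | rfl⟩ := n.even_or_odd'
  · rw [PowerSeries.coeff_expand_mul, coeff_onceSeries]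
    simp
  · rw [PowerSeries.coeff_expand_of_not_dvd _ _ _ (by omega)]
    simp

theorem genFun_odd (s : Bool) :
    genFun (fun n => if n.bodd = true then onceNum s n else 0) =
      x * toLaurent (onceSeries s 1) := by
  rw [genFun, toLaurent_apply, x, ← map_mul]
  congr 1
  ext n
  rw [PowerSeries.coeff_mk]
  obtain ⟨m, rfl | rfl⟩ := n.even_or_odd'
  · cases m with
    | zero => simp
    | succ m =>
      rw [show 2 * (m + 1) = 2 * m + 1 + 1 by ring, PowerSeries.coeff_succ_X_mul,
        PowerSeries.coeff_expand_of_not_dvd _ _ _ (by omega)]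
      simp
  · rw [PowerSeries.coeff_succ_X_mul, PowerSeries.coeff_expand_mul, coeff_onceSeries]
    simp

theorem genFun_isUpDown :
    genFun (fun n => countOnce n IsUpDown) = x * (1 - root) / (1 - 4 * x ^ 2 + root) := by
  have h := congrArg toLaurent onceSeries_true_one
  simp only [map_mul, map_sub, map_one, map_ofNat, toLaurent_X] at h
  have hx := x_ne_zero
  have h₀ : 1 - 4 * x ^ 2 + root ≠ 0 := by
    rw [← root_sq, show root ^ 2 + root = root * (root + 1) by ring]
    exact mul_ne_zero root_ne_zero root_add_one_ne_zero
  simp only [countOnce_isUpDown]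
  rw [genFun_odd, eq_div_iff h₀]
  refine mul_left_cancel₀ (mul_ne_zero two_ne_zero_laurentSeries hx) ?_
  linear_combination (1 - 4 * x ^ 2 + root) * h -
    (1 - 2 * x ^ 2) * toLaurent centralSeries * root_sq +
    (1 - 2 * x ^ 2) * (root + 1) * toLaurent_centralSeries_mul_root

theorem genFun_isUpUp :
    genFun (fun n => countOnce n IsUpUp) =
      (x ^ 2 - 1) / x ^ 2 + (1 - 3 * x ^ 2) / (x ^ 2 * root) := by
  have h := congrArg toLaurent onceSeries_true_zero
  simp only [map_mul, map_sub, map_add, map_one, map_ofNat, toLaurent_X,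
    toLaurent_centralSeries] at h
  have hx := x_ne_zero
  have hr := root_ne_zero
  simp only [countOnce_isUpUp]
  rw [genFun_even]
  field_simp at h ⊢
  linear_combination h

theorem genFun_isDownUp :
    genFun (fun n => countOnce n IsDownUp) = (2 * x ^ 4 + 4 * x ^ 2 - 3) / (2 * x ^ 3) +
      (3 - 10 * x ^ 2) / (2 * x ^ 3 * root) := by
  have h := congrArg toLaurent onceSeries_false_one
  simp only [map_mul, map_sub, map_add, map_pow, map_ofNat, toLaurent_X,
    toLaurent_centralSeries] at h
  have hx := x_ne_zero
  have hr := root_ne_zero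
  have h2 := two_ne_zero_laurentSeries
  simp only [countOnce_isDownUp]
  rw [genFun_odd]
  field_simp at h ⊢
  linear_combination h

end Alt132

theorem theorem4p2 :
    -- up-down permutations
    (Alt132.genFun (fun n => Alt132.countOnce n Alt132.IsUpDown) =
        Alt132.x * (1 - Alt132.root) / (1 - 4 * Alt132.x ^ 2 + Alt132.root) ∧
      ∀ n : ℕ, (Alt132.countOnce n Alt132.IsUpDown : ℚ) =
        Alt132.binom ((n : ℤ) - 1) (((n : ℚ) - 3) / 2)) ∧
    -- up-up permutations
    (Alt132.genFun (fun n => Alt132.countOnce n Alt132.IsUpUp) =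
        (Alt132.x ^ 2 - 1) / Alt132.x ^ 2 +
          (1 - 3 * Alt132.x ^ 2) / (Alt132.x ^ 2 * Alt132.root) ∧
      ∀ n : ℕ, (Alt132.countOnce n Alt132.IsUpUp : ℚ) =
        2 * Alt132.binom ((n : ℤ) - 1) (((n : ℚ) - 4) / 2)) ∧
    -- down-down permutations
    (Alt132.genFun (fun n => Alt132.countOnce n Alt132.IsDownDown) =
        (Alt132.x ^ 2 - 1) / Alt132.x ^ 2 +
          (1 - 3 * Alt132.x ^ 2) / (Alt132.x ^ 2 * Alt132.root) ∧
      ∀ n : ℕ, (Alt132.countOnce n Alt132.IsDownDown : ℚ) =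
        2 * Alt132.binom ((n : ℤ) - 1) (((n : ℚ) - 4) / 2)) ∧
    -- down-up permutations
    (Alt132.genFun (fun n => Alt132.countOnce n Alt132.IsDownUp) =
        (2 * Alt132.x ^ 4 + 4 * Alt132.x ^ 2 - 3) / (2 * Alt132.x ^ 3) +
          (3 - 10 * Alt132.x ^ 2) / (2 * Alt132.x ^ 3 * Alt132.root) ∧
      ∀ n : ℕ, n ≠ 1 → (Alt132.countOnce n Alt132.IsDownUp : ℚ) =
        3 / 2 * Alt132.binom ((n : ℤ) + 3) (((n : ℚ) + 3) / 2) -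
          5 * Alt132.binom ((n : ℤ) + 1) (((n : ℚ) + 1) / 2)) ∧
    -- alternating permutations
    (∀ n : ℕ, (Alt132.countOnce n Alt132.IsAlternating : ℚ) =
      Alt132.binom ((n : ℤ) - 1) (((n : ℚ) - 3) / 2) +
        2 * Alt132.binom ((n : ℤ) - 1) (((n : ℚ) - 4) / 2)) := by
  refine ⟨⟨Alt132.genFun_isUpDown, Alt132.countOnce_isUpDown_eq_binom⟩,
    ⟨Alt132.genFun_isUpUp, Alt132.countOnce_isUpUp_eq_binom⟩, ?_,
    ⟨Alt132.genFun_isDownUp, fun _ hn => Alt132.countOnce_isDownUp_eq_binom hn⟩,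
    Alt132.countOnce_isAlternating_eq_binom⟩
  simp only [Alt132.countOnce_isDownDown_eq]
  exact ⟨Alt132.genFun_isUpUp, Alt132.countOnce_isUpUp_eq_binom⟩
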